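/- **Setting.** Let $\mathcal W=\mathbb R^d$ carry an arbitrary norm $\|\cdot\|$, with dual norm $\|\cdot\|_*$ on $\mathcal W^*=\mathbb R^d$ and pairing $\langle w,x\rangle$. For a differentiable $\Psi:\mathcal W\to\mathbb R$ put $D_\Psi(\tilde w,w)=\Psi(\tilde w)-\Psi(w)-\langle \tilde w-w,\nabla\Psi(w)\rangle$. For $\sigma,L>0$ we call $\Psi$ *$\sigma$-strongly convex* if $D_\Psi(\tilde w,w)\ge\frac{\sigma}{2}\|\tilde w-w\|^2$ for all $\tilde w,w$, and *$L$-strongly smooth* if $D_\Psi(\tilde w,w)\le\frac{L}{2}\|\tilde w-w\|^2$ for all $\tilde w,w$. A *mirror map* is a Fréchet differentiable $\Psi$ that is $\sigma$-strongly convex for some $\sigma>0$. For $1<p\le2$ let $\Psi_p(w)=\frac12\|w\|_p^2$. Let $\rho$ be a Borel probability measure on $\mathcal X\times\mathcal Y$ with $\mathcal X\subset\mathcal W^*$, $\mathcal Y\subset\mathbb R$, and let $(X,Y)\sim\rho$. Assume $R:=\sup_{x\in\mathcal X}\|x\|_*<\infty$, $\mathbb E[Y^2]<\infty$, and that $\mathcal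 C_X=\mathbb E[XX^\top]$ is positive definite. Put $w_\rho=\mathcal C_X^{-1}\mathbb E[XY]$. Let $\Psi$ be either $\Psi_p$ for some $1<p\le 2$, or a mirror map that is $L$-strongly smooth for some $L>0$. Let $z_t=(x_t,y_t)$, $t=1,2,\dots$, be independent with law $\rho$, let $\eta_t>0$, let $w_1\in\mathcal W$ be deterministic, and let $(w_t)_{t\ge1}$ satisfy $$\nabla\Psi(w_{t+1})=\nabla\Psi(w_t)-\eta_t\big[\langle w_t,x_t\rangle-y_t\big]x_t,\qquad t\ge1 .$$ **Theorem.** All the expectations $\mathbb E\|w_\rho-w_t\|^2$ are finite, and the following hold. (a) Assume $\inf_{w\in\mathcal W}\mathbb E\big[|Y-\langle w,X\rangle|\,\|X\|_*\big]>0$. Then $$\lim_{t\to\infty}\mathbb E\|w_\rho-w_t\|^2=0\iff \lim_{t\to\infty}\eta_t=0\ \text{ and }\ \sum_{t=1}^\infty\eta_t=\infty .$$ If moreover $\Psi$ is strongly smooth and $\eta_t\to0$, there are $\tilde T_1\in\mathbb N$ and $\tilde C>0$ with $\mathbb E\|w_\rho-w_T\|^2\ge\tilde C\,T^{-1}$ for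 all $T\ge\tilde T_1$. If $\Psi$ is $L$-strongly smooth and $\eta_t=\frac{4}{(t+1)\sigma}$ for all $t\ge 1$ with $\sigma=\frac{2\lambda_{\min}\beta}{L}$, where $\lambda_{\min}$ is the smallest eigenvalue of $\mathcal C_X$ and $\beta>0$ is any constant with $\beta\|w\|^2\le\|w\|_2^2$ for all $w\in\mathcal W$, then $\mathbb E\|w_\rho-w_T\|^2=O(T^{-1})$. (b) Assume $w_\rho\ne w_1$ and $\mathbb E\big[|Y-\langle w_\rho,X\rangle|\,\|X\|_*\big]=0$, and let $\Psi$ be $\sigma_\Psi$-strongly convex, $\sigma_\Psi>0$. If for some $\kappa>0$ one has $\eta_t\le\frac{\sigma_\Psi}{(2+\kappa)R^2}$ for all $t\ge 1$, then $$\lim_{t\to\infty}\mathbb E\|w_\rho-w_t\|^2=0\iff\sum_{t=1}^\infty\eta_t=\infty .$$ If $\Psi$ is $L$-strongly smooth and $\eta_t\equiv\eta_1<\frac{\sigma_\Psi}{2R^2}$, there are $\tilde c_1,\tilde c_2\in(0,1)$ such that $$\tilde c_1^{\,T}\|w_\rho-w_1\|^2\le\mathbb E\|w_\rho-w_T\|^2\le\frac{L}{\sigma_\Psi}\,\tilde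 c_2^{\,T-1}\|w_\rho-w_1\|^2\qquad\text{for all }T\ge 1 .$$ (c) If $\sum_{t=1}^\infty\eta_t=\infty$ and $\sum_{t=1}^\infty\eta_t^2<\infty$, then $\|w_\rho-w_t\|^2\to0$ almost surely. -/

import Mathlib

open Filter Topology MeasureTheory ProbabilityTheory Asymptotics

noncomputable section

/-- The `p`-norm of the coordinate vector of `w` with respect to the basis `b`. -/
def pNorm {d : ℕ} {E : Type*} [NormedAddCommGroup E] [NormedSpace ℝ E]
    (b : Module.Basis (Fin d) ℝ E) (p : ℝ) (w : E) : ℝ :=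
  (∑ i, |b.repr w i| ^ p) ^ (1 / p)

/-- The `p`-norm divergence `Ψ_p(w) = ½ ‖w‖_p²`. -/
def pNormDivergence {d : ℕ} {E : Type*} [NormedAddCommGroup E] [NormedSpace ℝ E]
    (b : Module.Basis (Fin d) ℝ E) (p : ℝ) (w : E) : ℝ :=
  1 / 2 * pNorm b p w ^ 2

/-- The Bregman distance `D_Ψ(u, w) = Ψ(u) - Ψ(w) - ⟨u - w, ∇Ψ(w)⟩`, where the gradient
`∇Ψ(w)`, an element of the dual space, is the Fréchet derivative. -/
def bregman {E : Type*} [NormedAddCommGroup E] [NormedSpace ℝ E]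
    (Ψ : E → ℝ) (u w : E) : ℝ :=
  Ψ u - Ψ w - fderiv ℝ Ψ w (u - w)

/-- `Ψ` is `σ`-strongly convex with respect to the norm of `E`. -/
def IsStronglyConvex {E : Type*} [NormedAddCommGroup E] [NormedSpace ℝ E]
    (Ψ : E → ℝ) (σ : ℝ) : Prop :=
  ∀ u w : E, σ / 2 * ‖u - w‖ ^ 2 ≤ bregman Ψ u w

/-- `Ψ` is `L`-strongly smooth with respect to the norm of `E`. -/
def IsStronglySmooth {E : Type*} [NormedAddCommGroup E] [NormedSpace ℝ E]
    (Ψ : E → ℝ) (L : ℝ) : Prop :=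
  ∀ u w : E, bregman Ψ u w ≤ L / 2 * ‖u - w‖ ^ 2

/-- A mirror map: Fréchet differentiable and strongly convex. -/
def IsMirrorMap {E : Type*} [NormedAddCommGroup E] [NormedSpace ℝ E] (Ψ : E → ℝ) : Prop :=
  Differentiable ℝ Ψ ∧ ∃ σ : ℝ, 0 < σ ∧ IsStronglyConvex Ψ σ

/-- The covariance matrix `E[X Xᵀ]`; the `i`-th coordinate of an input `x` in the dual space
is `x (b i)`. -/
def covMatrix {d : ℕ} {E : Type*} [NormedAddCommGroup E] [NormedSpace ℝ E]
    (b : Module.Basis (Fin d) ℝ E) {𝒳 : Set (StrongDual ℝ E)} {𝒴 : Set ℝ}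
    (ρ : Measure (𝒳 × 𝒴)) : Matrix (Fin d) (Fin d) ℝ :=
  Matrix.of fun i j => ∫ z, (z.1 : StrongDual ℝ E) (b i) * (z.1 : StrongDual ℝ E) (b j) ∂ρ

/-- The least-squares target `w_ρ = (E[X Xᵀ])⁻¹ E[X Y]`. -/
def wRho {d : ℕ} {E : Type*} [NormedAddCommGroup E] [NormedSpace ℝ E]
    (b : Module.Basis (Fin d) ℝ E) {𝒳 : Set (StrongDual ℝ E)} {𝒴 : Set ℝ}
    (ρ : Measure (𝒳 × 𝒴)) : E :=
  b.equivFun.symm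
    ((covMatrix b ρ)⁻¹.mulVec fun i => ∫ z, (z.1 : StrongDual ℝ E) (b i) * (z.2 : ℝ) ∂ρ)

/-- `E[|Y - ⟨w, X⟩| ‖X‖_*]`; the norm of `StrongDual ℝ E` is the dual norm. -/
def meanGradNorm {E : Type*} [NormedAddCommGroup E] [NormedSpace ℝ E]
    {𝒳 : Set (StrongDual ℝ E)} {𝒴 : Set ℝ} (ρ : Measure (𝒳 × 𝒴)) (w : E) : ℝ :=
  ∫ z, |(z.2 : ℝ) - (z.1 : StrongDual ℝ E) w| * ‖(z.1 : StrongDual ℝ E)‖ ∂ρ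

/-- `w 1, w 2, …` are the iterates of least-squares online mirror descent started at `w₁`, run
with step sizes `η 1, η 2, …` on the samples `z 1, z 2, …`:
`∇Ψ(w_{t+1}) = ∇Ψ(w_t) - η_t (⟨w_t, x_t⟩ - y_t) x_t`. Entries at index `0` are not used. -/
structure IsLeastSquaresOMD {E : Type*} [NormedAddCommGroup E] [NormedSpace ℝ E]
    {𝒳 : Set (StrongDual ℝ E)} {𝒴 : Set ℝ} {Ω : Type*}
    (Ψ : E → ℝ) (η : ℕ → ℝ) (w₁ : E) (z : ℕ → Ω → 𝒳 × 𝒴) (w : ℕ → Ω → E) : Prop where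
  init : ∀ ω, w 1 ω = w₁
  step : ∀ t, 1 ≤ t → ∀ ω,
    fderiv ℝ Ψ (w (t + 1) ω) = fderiv ℝ Ψ (w t ω) -
      (η t * (((z t ω).1 : StrongDual ℝ E) (w t ω) - ((z t ω).2 : ℝ))) •
        ((z t ω).1 : StrongDual ℝ E)

/-- `∑_{t ≥ 1} η_t = ∞`. -/
def StepSumDiverges (η : ℕ → ℝ) : Prop :=
  Tendsto (fun T : ℕ => ∑ t ∈ Finset.Icc 1 T, η t) atTop atTop

end

/-! Everything is read off `D_t = E D_Ψ(w_ρ, w_t)`. The three-point identity expresses one mirror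
step exactly; since `z_t` is independent of `w_t` and `w_ρ` solves the normal equations, taking
means gives `D_{t+1} = D_t - η_t E[excess risk of w_t] + E D_Ψ(w_t, w_{t+1})`
(`integral_bregman_next_eq`). The excess risk `E⟨w - w_ρ, X⟩²` lies between positive multiples of
`‖w - w_ρ‖²`, below because the covariance is positive definite and above because inputs are
bounded. By strong convexity the last term is at most `η_t² R² (excess risk + V) / (2σ)`, where `V`
is the mean squared residual at `w_ρ`, or `0` in the noiseless case.

Upper bounds: for small steps `D_t` drops by a multiple of `η_t` up to a noise term of order `η_t²`.
This yields mean convergence when `∑ η_t = ∞`, the rate `O(1/T)` for steps of order `1/t`, and a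
linear rate without noise.

Lower bounds: `D_{t+1} ≥ (1 - k η_t) D_t`, so a summable step sequence cannot bring a nonzero `D_t`
to zero. With noise the gradient moves by at least `m η_t` in mean; convergence makes consecutive
gradients both approach `∇Ψ(w_ρ)`, hence `η_t → 0`. If `Ψ` is also smooth, the move adds at least a
multiple of `η_t²` to `D_{t+1}`, which rules out decay faster than `1/T`.

Almost sure convergence: up to a summable correction `D_Ψ(w_ρ, w_t)` is a nonnegative
supermartingale, so it converges, and mean convergence with Fatou identifies the limit as `0`.

`Ψ_p` need not be strongly smooth. Linear growth of its gradient still gives `D_Ψ ≤ ε + C_ε ‖·‖²`,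
which suffices for limits; its strong convexity in an arbitrary norm comes from homogeneity and
equivalence of norms. -/

/-! ### Real recursions: convergence, divergence of steps, rates. -/

section Sequences

variable {a b η δ : ℕ → ℝ}

/-- A nonnegative sequence that decreases by a definite multiple of `η t` whenever it is not
small tends to zero if the steps `η t` are not summable. -/
theorem tendsto_zero_of_descent {N : ℕ} (ha : ∀ t, N ≤ t → 0 ≤ a t)
    (hη : ∀ t, N ≤ t → 0 ≤ η t) (hb0 : ∀ t, N ≤ t → 0 ≤ b t)
    (hrec : ∀ t, N ≤ t → a (t + 1) ≤ a t - η t * (b t - δ t))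
    (hb : ∀ ε : ℝ, 0 < ε → ∃ c : ℝ, 0 < c ∧ ∀ t, N ≤ t → ε ≤ a t → c ≤ b t)
    (hδ : Tendsto δ atTop (𝓝 0)) (hηδ : Tendsto (fun t => η t * δ t) atTop (𝓝 0))
    (hsum : StepSumDiverges η) : Tendsto a atTop (𝓝 0) := by
  have key : ∀ ε : ℝ, 0 < ε → ∀ᶠ t in atTop, a t < 2 * ε := by
    intro ε hε
    obtain ⟨c, hc, hcb⟩ := hb ε hε
    have h1 : ∀ᶠ t in atTop, δ t < c / 2 := hδ.eventually_lt_const (by positivity)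
    have h2 : ∀ᶠ t in atTop, η t * δ t < ε := hηδ.eventually_lt_const hε
    obtain ⟨N₁, hN₁⟩ := eventually_atTop.1 (h1.and (h2.and (eventually_ge_atTop N)))
    have hdec : ∀ t, N₁ ≤ t → ε ≤ a t → a (t + 1) ≤ a t - c / 2 * η t := by
      intro t ht hat
      obtain ⟨hd, -, hNt⟩ := hN₁ t ht
      nlinarith [hrec t hNt, hcb t hNt hat, hη t hNt]
    -- Staying above `ε` forever would subtract `c / 2` times the unbounded step sum from a
    -- nonnegative quantity.
    have hex : ∃ t, N₁ ≤ t ∧ a t < ε := by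
      by_contra! hcon
      have hbound : ∀ T, N₁ ≤ T → a (T + 1) + c / 2 * ∑ t ∈ Finset.Icc 1 T, η t ≤
          a (N₁ + 1) + c / 2 * ∑ t ∈ Finset.Icc 1 N₁, η t := by
        intro T hT
        induction T, hT using Nat.le_induction with
        | base => exact le_rfl
        | succ T hT ih =>
          rw [Finset.sum_Icc_succ_top (by omega)]
          have := hdec (T + 1) (by omega) (hcon _ (by omega))
          linarith
      obtain ⟨T, hT1, hT2⟩ := ((hsum.eventually_gt_atTop
        ((a (N₁ + 1) + c / 2 * ∑ t ∈ Finset.Icc 1 N₁, η t) / (c / 2))).and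
        (eventually_ge_atTop N₁)).exists
      rw [div_lt_iff₀ (by positivity)] at hT1
      have h3 := hbound T hT2
      have h4 := ha (T + 1) (by have := (hN₁ T hT2).2.2; omega)
      linarith
    obtain ⟨t₁, ht₁, hat₁⟩ := hex
    filter_upwards [eventually_ge_atTop t₁] with t ht
    induction t, ht using Nat.le_induction with
    | base => linarith
    | succ t ht ih =>
      -- Below `ε` one step adds at most `η t * δ t < ε`; between `ε` and `2 * ε` the sequence does
      -- not increase. Hence `2 * ε` is never crossed again.
      obtain ⟨hd, he, hNt⟩ := hN₁ t (ht₁.trans ht)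
      rcases lt_or_ge (a t) ε with h | h
      · nlinarith [hrec t hNt, hb0 t hNt, hη t hNt, mul_nonneg (hη t hNt) (hb0 t hNt)]
      · have := hdec t (ht₁.trans ht) h
        nlinarith [hη t hNt]
  rw [Metric.tendsto_atTop]
  intro ε hε
  obtain ⟨M, hM⟩ := eventually_atTop.1 ((key (ε / 2) (by positivity)).and
    (eventually_ge_atTop N))
  refine ⟨M, fun t ht => ?_⟩
  obtain ⟨h1, h2⟩ := hM t ht
  rw [Real.dist_eq, sub_zero, abs_of_nonneg (ha t h2)]
  linarith

/-- If the partial sums of a positive sequence do not diverge, the tails are small. -/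
theorem exists_tail_le_of_not_stepSumDiverges (hη : ∀ t, 1 ≤ t → 0 < η t)
    (hsum : ¬ StepSumDiverges η) {ε : ℝ} (hε : 0 < ε) :
    ∃ N, ∀ n, N ≤ n → ∀ T, n ≤ T →
      ∑ t ∈ Finset.Icc 1 T, η t - ∑ t ∈ Finset.Icc 1 n, η t ≤ ε := by
  have hmono : Monotone fun T : ℕ => ∑ t ∈ Finset.Icc 1 T, η t := by
    refine monotone_nat_of_le_succ fun T => ?_
    rw [Finset.sum_Icc_succ_top (by omega)]
    linarith [hη (T + 1) (by omega)]
  rcases tendsto_atTop_of_monotone hmono with h | ⟨l, hl⟩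
  · exact absurd h hsum
  · obtain ⟨N, hN⟩ := eventually_atTop.1 (hl.eventually_const_lt (sub_lt_self l hε))
    refine ⟨N, fun n hn T _ => ?_⟩
    have h1 := hmono.ge_of_tendsto hl T
    have h2 := hN n hn
    linarith

/-- A sequence with `a (t + 1) ≥ (1 - k η t) a t` that tends to zero without being eventually
zero forces the steps to be non-summable. -/
theorem stepSumDiverges_of_tendsto_zero (hη : ∀ t, 1 ≤ t → 0 < η t) {k : ℝ} (hk : 0 ≤ k)
    (hsmall : ∀ᶠ t in atTop, k * η t ≤ 1)
    (hrec : ∀ t, 1 ≤ t → (1 - k * η t) * a t ≤ a (t + 1))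
    (hpos : ∀ n, ∃ t, n ≤ t ∧ 0 < a t)
    (hlim : Tendsto a atTop (𝓝 0)) : StepSumDiverges η := by
  by_contra hsum
  -- Chosen so that `k` times the tail is at most `1 / 2`; `k + 1` avoids dividing by zero.
  obtain ⟨N, hN⟩ := exists_tail_le_of_not_stepSumDiverges hη hsum
    (ε := 1 / (2 * (k + 1))) (by positivity)
  obtain ⟨M, hM⟩ := eventually_atTop.1 hsmall
  obtain ⟨m, hm, ham⟩ := hpos (max N M + 1)
  obtain ⟨n, rfl⟩ : ∃ n, m = n + 1 := ⟨m - 1, by omega⟩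
  have hnN : N ≤ n := by omega
  have hnM : M ≤ n := by omega
  -- The Weierstrass inequality `∏ (1 - k η) ≥ 1 - k ∑ η`. Nonnegativity of the tail is carried
  -- along because it lets the second-order product term be dropped.
  have hlow : ∀ T, n ≤ T →
      (1 - k * (∑ t ∈ Finset.Icc 1 T, η t - ∑ t ∈ Finset.Icc 1 n, η t)) * a (n + 1) ≤
        a (T + 1) ∧ 0 ≤ ∑ t ∈ Finset.Icc 1 T, η t - ∑ t ∈ Finset.Icc 1 n, η t := by
    intro T hT
    induction T, hT using Nat.le_induction with
    | base => simp
    | succ T hT ih =>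
      rw [Finset.sum_Icc_succ_top (by omega)]
      set S := ∑ t ∈ Finset.Icc 1 T, η t - ∑ t ∈ Finset.Icc 1 n, η t with hS
      obtain ⟨ih, hS0⟩ := ih
      have h1 := hrec (T + 1) (by omega)
      have h2 := hM (T + 1) (by omega)
      have h3 := hη (T + 1) (by omega)
      have h4 : (1 - k * η (T + 1)) * ((1 - k * S) * a (n + 1)) ≤
          (1 - k * η (T + 1)) * a (T + 1) := mul_le_mul_of_nonneg_left ih (by linarith)
      have h5 : 0 ≤ k * η (T + 1) * (k * S) * a (n + 1) := by positivity
      refine ⟨?_, by linarith⟩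
      have : ∑ t ∈ Finset.Icc 1 T, η t + η (T + 1) - ∑ t ∈ Finset.Icc 1 n, η t =
        S + η (T + 1) := by rw [hS]; ring
      rw [this]
      nlinarith
  obtain ⟨T, hT1, hT2⟩ := ((((tendsto_add_atTop_iff_nat 1).2 hlim).eventually_lt_const
    (show (0 : ℝ) < a (n + 1) / 2 by positivity)).and (eventually_ge_atTop n)).exists
  have h1 := (hlow T hT2).1
  have h2 := hN n hnN T hT2
  have h3 : k * (∑ t ∈ Finset.Icc 1 T, η t - ∑ t ∈ Finset.Icc 1 n, η t) ≤ 1 / 2 := by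
    calc _ ≤ k * (1 / (2 * (k + 1))) := mul_le_mul_of_nonneg_left h2 hk
      _ ≤ 1 / 2 := by
        rw [mul_one_div, div_le_div_iff₀ (by positivity) (by positivity)]; linarith
  nlinarith

/-- A sequence with `a (t + 1) ≥ (1 - k η t) a t + q (η t)²` decays at most like `1 / t`. -/
theorem exists_div_le_of_recursion {k q : ℝ} (hk : 0 < k) (hq : 0 < q) {N : ℕ} (hN : 1 ≤ N)
    (hsmall : ∀ t, N ≤ t → k * η t ≤ 1 / 2)
    (hrec : ∀ t, N ≤ t → (1 - k * η t) * a t + q * η t ^ 2 ≤ a (t + 1)) (hpos : 0 < a N) :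
    ∃ C : ℝ, 0 < C ∧ ∀ t : ℕ, N ≤ t → C * (t : ℝ)⁻¹ ≤ a t := by
  -- Minimising `-k η a + q η²` over `η` gives `-K a²`, so whatever the step, `a (t + 1) ≥ a t - K
  -- (a t)²`.
  set K : ℝ := k ^ 2 / (4 * q) with hKdef
  have hK : 0 < K := by positivity
  have hN' : (1 : ℝ) ≤ N := by exact_mod_cast hN
  refine ⟨min (1 / (4 * K)) (N * a N), by positivity, fun t ht => ?_⟩
  set C := min (1 / (4 * K)) (N * a N) with hC
  have hC0 : 0 < C := by positivity
  have hCK : C * K ≤ 1 / 4 := by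
    calc C * K ≤ 1 / (4 * K) * K := mul_le_mul_of_nonneg_right (min_le_left _ _) hK.le
      _ = 1 / 4 := by field_simp
  induction t, ht using Nat.le_induction with
  | base =>
    rw [← div_eq_mul_inv, div_le_iff₀ (by linarith), mul_comm (a N)]
    exact min_le_right _ _
  | succ t ht ih =>
    have ht0 : (1 : ℝ) ≤ t := by exact_mod_cast hN.trans ht
    have h1 := hrec t ht
    have hat : 0 ≤ a t := le_trans (by positivity) ih
    rw [← div_eq_mul_inv] at ih ⊢
    push_cast
    -- The map `x ↦ x - K x²` increases up to `1 / (2 * K)`, so the inductive lower bound can be fed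
    -- into it. Above that value, `k η ≤ 1 / 2` keeps at least half of `a t`, that is `1 / (4 * K)`.
    rcases le_total (a t) (1 / (2 * K)) with h | h
    · have h2 : a t - K * a t ^ 2 ≤ a (t + 1) := by
        have : 0 ≤ (k * a t - 2 * q * η t) ^ 2 / (4 * q) := by positivity
        have h3 : (k * a t - 2 * q * η t) ^ 2 / (4 * q) =
            K * a t ^ 2 - k * η t * a t + q * η t ^ 2 := by rw [hKdef]; field_simp; ring
        linarith
      have h3 : C / t - K * (C / t) ^ 2 ≤ a t - K * a t ^ 2 := by
        have h4 : K * (a t + C / t) ≤ 1 := by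
          have : K * a t ≤ K * (1 / (2 * K)) := mul_le_mul_of_nonneg_left h hK.le
          have h5 : K * (1 / (2 * K)) = 1 / 2 := by field_simp
          have h6 : K * (C / t) ≤ K * a t := mul_le_mul_of_nonneg_left ih hK.le
          linarith
        nlinarith [mul_nonneg (sub_nonneg.2 ih) (sub_nonneg.2 h4)]
      have h4 : C / (t + 1) ≤ C / t - K * (C / t) ^ 2 := by
        have : C / t - K * (C / t) ^ 2 - C / (t + 1) =
            C * (t - C * K * (t + 1)) / (t ^ 2 * (t + 1)) := by field_simp; ring
        have h5 : 0 ≤ C * (t - C * K * (t + 1)) / (t ^ 2 * (t + 1)) := by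
          apply div_nonneg _ (by positivity)
          apply mul_nonneg hC0.le
          nlinarith
        linarith
      linarith
    · have h2 : 1 / (4 * K) ≤ a (t + 1) := by
        have h3 : 1 / (4 * K) = 1 / 2 * (1 / (2 * K)) := by field_simp; norm_num
        have h4 := hsmall t ht
        have : 0 ≤ q * η t ^ 2 := by positivity
        rw [h3]
        nlinarith
      have h3 : C / (t + 1) ≤ C := div_le_self hC0.le (by linarith)
      exact h3.trans ((min_le_left _ _).trans h2)

/-- A nonnegative sequence with `a (t + 1) ≤ (1 - 2 / (t + 1)) a t + K / (t + 1)²` is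
`O(1 / t)`. -/
theorem isBigO_inv_of_recursion {K : ℝ} (hK : 0 ≤ K) {N : ℕ} (ha : ∀ t, N ≤ t → 0 ≤ a t)
    (hrec : ∀ t : ℕ, N ≤ t →
      a (t + 1) ≤ (1 - 2 / ((t : ℝ) + 1)) * a t + K / ((t : ℝ) + 1) ^ 2) :
    a =O[atTop] fun t : ℕ => (t : ℝ)⁻¹ := by
  -- The weight `t (t - 1)` telescopes: `(t + 1) t (1 - 2 / (t + 1)) = t (t - 1)`, and each weighted
  -- noise term is at most `K`.
  have hbound : ∀ t : ℕ, N ≤ t →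
      (t : ℝ) * (t - 1) * a t ≤ (N : ℝ) * (N - 1) * a N + K * (t - N) := by
    intro t ht
    induction t, ht using Nat.le_induction with
    | base => simp
    | succ t ht ih =>
      have h0 : (0 : ℝ) ≤ t := t.cast_nonneg
      have h1 := mul_le_mul_of_nonneg_left (hrec t ht) (show (0 : ℝ) ≤ (t + 1) * t by positivity)
      have h2 : ((t : ℝ) + 1) * t * ((1 - 2 / ((t : ℝ) + 1)) * a t + K / ((t : ℝ) + 1) ^ 2) =
          t * (t - 1) * a t + K * (t / (t + 1)) := by field_simp; ring
      have h3 : K * ((t : ℝ) / (t + 1)) ≤ K * 1 :=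
        mul_le_mul_of_nonneg_left ((div_le_one (by positivity)).2 (by linarith)) hK
      push_cast
      nlinarith
  set B := |(N : ℝ) * (N - 1) * a N| with hB
  refine IsBigO.of_bound (2 * (B + K)) ?_
  filter_upwards [eventually_ge_atTop (max N 2)] with t ht
  have htN : N ≤ t := le_trans (le_max_left _ _) ht
  have ht2 : (2 : ℝ) ≤ t := by exact_mod_cast le_trans (le_max_right _ _) ht
  rw [Real.norm_of_nonneg (ha t htN), Real.norm_of_nonneg (by positivity), ← div_eq_mul_inv,
    le_div_iff₀ (by linarith)]
  have h1 := hbound t htN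
  have h2 : (N : ℝ) * (N - 1) * a N ≤ B := le_abs_self _
  have hB0 : 0 ≤ B := abs_nonneg _
  have h3 : (0 : ℝ) ≤ N := N.cast_nonneg
  have h4 : (t : ℝ) * (t - 1) * a t ≤ (B + K) * t := by nlinarith
  have h5 : (t - 1 : ℝ) * a t ≤ B + K := by
    by_contra! hcon
    nlinarith
  nlinarith [ha t htN]

end Sequences

/-! ### Bregman divergences of strongly convex and strongly smooth functions. -/

section Bregman

variable {E : Type*} [NormedAddCommGroup E] [NormedSpace ℝ E] {Ψ : E → ℝ} {σ L : ℝ}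

/-- The gradient of `Ψ` grows at most linearly. -/
def HasLinearGradGrowth (Ψ : E → ℝ) : Prop :=
  ∃ C : ℝ, 0 < C ∧ ∀ w, ‖fderiv ℝ Ψ w‖ ≤ C * (1 + ‖w‖)

theorem bregman_three_point (u w v : E) :
    bregman Ψ u v = bregman Ψ u w + bregman Ψ w v + (fderiv ℝ Ψ w - fderiv ℝ Ψ v) (u - w) := by
  have : u - v = (u - w) + (w - v) := by abel
  simp only [bregman, sub_apply]
  rw [this, map_add]
  ring

theorem bregman_add_bregman_swap (u w : E) :
    bregman Ψ u w + bregman Ψ w u = (fderiv ℝ Ψ u - fderiv ℝ Ψ w) (u - w) := by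
  have : w - u = -(u - w) := by abel
  simp only [bregman, sub_apply]
  rw [this, map_neg]
  ring

@[simp]
theorem bregman_self (u : E) : bregman Ψ u u = 0 := by simp [bregman]

theorem IsStronglyConvex.bregman_nonneg (h : IsStronglyConvex Ψ σ) (hσ : 0 < σ) (u w : E) :
    0 ≤ bregman Ψ u w :=
  le_trans (by positivity) (h u w)

theorem IsStronglyConvex.norm_sub_sq_le (h : IsStronglyConvex Ψ σ) (hσ : 0 < σ) (u w : E) :
    ‖u - w‖ ^ 2 ≤ 2 / σ * bregman Ψ u w := by
  have := h u w
  rw [div_mul_eq_mul_div, le_div_iff₀ hσ]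
  linarith

theorem IsStronglyConvex.bregman_pos (h : IsStronglyConvex Ψ σ) (hσ : 0 < σ) {u w : E}
    (huw : u ≠ w) : 0 < bregman Ψ u w := by
  refine lt_of_lt_of_le ?_ (h u w)
  have := norm_pos_iff.2 (sub_ne_zero.2 huw)
  positivity

/-- Adding the strong convexity bounds in both orders makes the gradient strongly monotone. The
inverse of the gradient is therefore Lipschitz, which later controls an iterate that is only given
through its gradient. -/
theorem IsStronglyConvex.norm_sub_le (h : IsStronglyConvex Ψ σ) (hσ : 0 < σ) (u w : E) :
    ‖u - w‖ ≤ σ⁻¹ * ‖fderiv ℝ Ψ u - fderiv ℝ Ψ w‖ := by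
  rcases eq_or_ne u w with rfl | huw
  · simp
  have h0 := norm_pos_iff.2 (sub_ne_zero.2 huw)
  have h1 := bregman_add_bregman_swap (Ψ := Ψ) u w
  have h2 := h u w
  have h3 := h w u
  rw [norm_sub_rev] at h3
  have h4 := (le_abs_self _).trans ((fderiv ℝ Ψ u - fderiv ℝ Ψ w).le_opNorm (u - w))
  rw [inv_mul_eq_div, le_div_iff₀ hσ]
  nlinarith

/-- The symmetrised divergence is at most `g r`, with `g` the gradient gap and `r = ‖u - w‖`, and
the swapped divergence is at least `σ r² / 2`. The difference `g r - σ r² / 2` is largest at `r = g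
/ σ`. -/
theorem IsStronglyConvex.bregman_le_grad (h : IsStronglyConvex Ψ σ) (hσ : 0 < σ) (u w : E) :
    bregman Ψ u w ≤ ‖fderiv ℝ Ψ u - fderiv ℝ Ψ w‖ ^ 2 / (2 * σ) := by
  have h1 := bregman_add_bregman_swap (Ψ := Ψ) u w
  have h3 := h w u
  rw [norm_sub_rev] at h3
  have h4 := (le_abs_self _).trans ((fderiv ℝ Ψ u - fderiv ℝ Ψ w).le_opNorm (u - w))
  rw [le_div_iff₀ (by positivity)]
  nlinarith [sq_nonneg (‖fderiv ℝ Ψ u - fderiv ℝ Ψ w‖ - σ * ‖u - w‖)]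

theorem IsStronglyConvex.le_of_nontrivial [Nontrivial E] (h : IsStronglyConvex Ψ σ)
    (hL : IsStronglySmooth Ψ L) : σ ≤ L := by
  obtain ⟨u, w, huw⟩ := exists_pair_ne E
  have h0 := norm_pos_iff.2 (sub_ne_zero.2 huw)
  have h1 := (h u w).trans (hL u w)
  have := le_of_mul_le_mul_right h1 (by positivity)
  linarith

/-- A bound for a functional that holds on the sphere of radius `r` bounds its norm. -/
theorem ContinuousLinearMap.norm_le_of_sphere (f : StrongDual ℝ E) {r B : ℝ} (hr : 0 < r)
    (hB : 0 ≤ B) (h : ∀ v : E, ‖v‖ = r → f v ≤ B) : ‖f‖ ≤ B / r := by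
  refine f.opNorm_le_bound (by positivity) fun v => ?_
  rcases eq_or_ne v 0 with rfl | hv
  · simp
  have hv' := norm_pos_iff.2 hv
  have key : ∀ v' : E, ‖v'‖ = ‖v‖ → f v' ≤ B / r * ‖v‖ := by
    intro v' hv'n
    have h1 := h ((r / ‖v‖) • v') (by
      rw [norm_smul, hv'n, Real.norm_of_nonneg (by positivity)]; field_simp)
    rw [map_smul, smul_eq_mul, div_mul_eq_mul_div, div_le_iff₀ hv'] at h1
    rw [div_mul_eq_mul_div, le_div_iff₀ hr]
    linarith
  rw [Real.norm_eq_abs, abs_le]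
  have h2 := key (-v) (norm_neg v)
  rw [map_neg] at h2
  exact ⟨by linarith, key v rfl⟩

theorem bregman_sub_bregman (u w v : E) :
    bregman Ψ v u - bregman Ψ w u = Ψ v - Ψ w - fderiv ℝ Ψ u (v - w) := by
  have : v - u = (v - w) + (w - u) := by abel
  simp only [bregman]
  rw [this, map_add]
  ring

/-- For convex `Ψ`, gradients at two points differ by at most the Bregman divergence on the
sphere between them. -/
theorem IsStronglyConvex.grad_sub_apply_le (h : IsStronglyConvex Ψ σ) (hσ : 0 < σ) (u w v : E) :
    (fderiv ℝ Ψ w - fderiv ℝ Ψ u) v ≤ bregman Ψ (w + v) u := by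
  have h1 := h.bregman_nonneg hσ w u
  have h2 := h.bregman_nonneg hσ (w + v) w
  have h3 := bregman_sub_bregman (Ψ := Ψ) u w (w + v)
  have h4 : bregman Ψ (w + v) w = Ψ (w + v) - Ψ w - fderiv ℝ Ψ w v := by simp [bregman]
  simp only [add_sub_cancel_left] at h3
  rw [sub_apply]
  linarith

/-- The gradient gap is tested on the sphere of radius `r = ‖w - u‖`. There `w + v` is within `2 r`
of `u`, so smoothness gives `L / 2 * (2 r)²`, and division by `r` gives the factor `2 * L`, which is
not sharp but suffices. -/
theorem IsStronglySmooth.norm_grad_sub_le (hL : IsStronglySmooth Ψ L) (hL0 : 0 < L)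
    (h : IsStronglyConvex Ψ σ) (hσ : 0 < σ) (u w : E) :
    ‖fderiv ℝ Ψ w - fderiv ℝ Ψ u‖ ≤ 2 * L * ‖w - u‖ := by
  rcases eq_or_ne w u with rfl | huw
  · simp
  have h0 := norm_pos_iff.2 (sub_ne_zero.2 huw)
  have := ContinuousLinearMap.norm_le_of_sphere (fderiv ℝ Ψ w - fderiv ℝ Ψ u) h0
    (B := 2 * L * ‖w - u‖ ^ 2) (by positivity) fun v hv => by
      refine (h.grad_sub_apply_le hσ u w v).trans ((hL _ _).trans ?_)
      have h1 : ‖w + v - u‖ ≤ 2 * ‖w - u‖ := by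
        calc ‖w + v - u‖ = ‖(w - u) + v‖ := by congr 1; abel
          _ ≤ ‖w - u‖ + ‖v‖ := norm_add_le _ _
          _ = _ := by rw [hv]; ring
      have h2 : ‖w + v - u‖ ^ 2 ≤ (2 * ‖w - u‖) ^ 2 := by gcongr
      nlinarith
  refine this.trans_eq ?_
  field_simp

theorem IsStronglySmooth.hasLinearGradGrowth (hL : IsStronglySmooth Ψ L) (hL0 : 0 < L)
    (h : IsStronglyConvex Ψ σ) (hσ : 0 < σ) : HasLinearGradGrowth Ψ := by
  refine ⟨‖fderiv ℝ Ψ 0‖ + 2 * L, by positivity, fun w => ?_⟩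
  have h1 := hL.norm_grad_sub_le hL0 h hσ 0 w
  have h2 := norm_le_norm_sub_add (fderiv ℝ Ψ w) (fderiv ℝ Ψ 0)
  rw [sub_zero] at h1
  nlinarith [norm_nonneg w, norm_nonneg (fderiv ℝ Ψ 0),
    mul_nonneg (norm_nonneg w) (norm_nonneg (fderiv ℝ Ψ 0))]

/-- A substitute for strong smoothness that also covers `Ψ_p`. The divergence is at most `(B + C r)
r` with `r = ‖u - w‖`, and Young's inequality trades the linear term for `ε` plus a quadratic one.
-/
theorem HasLinearGradGrowth.bregman_le (hg : HasLinearGradGrowth Ψ)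
    (h : IsStronglyConvex Ψ σ) (hσ : 0 < σ) (u : E) {ε : ℝ} (hε : 0 < ε) :
    ∃ C : ℝ, 0 < C ∧ ∀ w, bregman Ψ u w ≤ ε + C * ‖u - w‖ ^ 2 := by
  obtain ⟨C, hC, hg⟩ := hg
  set B := C * (2 + 2 * ‖u‖) with hB
  have hB0 : 0 < B := by positivity
  refine ⟨B ^ 2 / (4 * ε) + C, by positivity, fun w => ?_⟩
  have h1 := bregman_add_bregman_swap (Ψ := Ψ) u w
  have h2 := h.bregman_nonneg hσ w u
  have h3 := (le_abs_self _).trans ((fderiv ℝ Ψ u - fderiv ℝ Ψ w).le_opNorm (u - w))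
  have h4 : ‖fderiv ℝ Ψ u - fderiv ℝ Ψ w‖ ≤ B + C * ‖u - w‖ := by
    refine (norm_sub_le _ _).trans ((add_le_add (hg u) (hg w)).trans ?_)
    have : ‖w‖ ≤ ‖u‖ + ‖u - w‖ := norm_le_norm_add_norm_sub u w
    nlinarith
  have h5 : ‖fderiv ℝ Ψ u - fderiv ℝ Ψ w‖ * ‖u - w‖ ≤ (B + C * ‖u - w‖) * ‖u - w‖ := by gcongr
  have h6 : 0 ≤ (B * ‖u - w‖ - 2 * ε) ^ 2 / (4 * ε) := by positivity
  have h7 : (B * ‖u - w‖ - 2 * ε) ^ 2 / (4 * ε) =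
      B ^ 2 / (4 * ε) * ‖u - w‖ ^ 2 - B * ‖u - w‖ + ε := by field_simp; ring
  nlinarith

/-- A convex differentiable function has a continuous gradient; together with linear growth this
gives a quadratic bound away from any prescribed error. -/
theorem HasLinearGradGrowth.norm_grad_sub_le (hg : HasLinearGradGrowth Ψ)
    (hd : Differentiable ℝ Ψ) (h : IsStronglyConvex Ψ σ) (hσ : 0 < σ) (u : E) {ε : ℝ}
    (hε : 0 < ε) :
    ∃ C : ℝ, 0 < C ∧ ∀ w, ‖fderiv ℝ Ψ w - fderiv ℝ Ψ u‖ ≤ ε + C * ‖u - w‖ ^ 2 := by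
  obtain ⟨C, hC, hg⟩ := hg
  have h1 := (hd u).hasFDerivAt.isLittleO.def (c := ε / 2) (by positivity)
  obtain ⟨r, hr, hball⟩ := Metric.eventually_nhds_iff.1 h1
  set B := C * (2 + 2 * ‖u‖) with hB
  have hB0 : 0 < B := by positivity
  -- Near `u`, differentiability alone bounds the gap by `ε`, with `w + v` at distance at most `2 *
  -- ‖w - u‖` from `u`. Far from `u`, `1 ≤ 2 / r * ‖u - w‖` is used twice to raise the linear bound
  -- to a quadratic one.
  refine ⟨(B * (2 / r) + C) * (2 / r), by positivity, fun w => ?_⟩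
  rcases lt_or_ge (2 * ‖w - u‖) r with hw | hw
  · rcases eq_or_ne w u with rfl | huw
    · simp [hε.le]
    have h0 := norm_pos_iff.2 (sub_ne_zero.2 huw)
    have := ContinuousLinearMap.norm_le_of_sphere (fderiv ℝ Ψ w - fderiv ℝ Ψ u) h0
      (B := ε * ‖w - u‖) (by positivity) fun v hv => by
        refine (h.grad_sub_apply_le hσ u w v).trans ?_
        have h2 : ‖w + v - u‖ ≤ 2 * ‖w - u‖ := by
          calc ‖w + v - u‖ = ‖(w - u) + v‖ := by congr 1; abel
            _ ≤ ‖w - u‖ + ‖v‖ := norm_add_le _ _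
            _ = _ := by rw [hv]; ring
        have h3 := hball (y := w + v) (by rw [dist_eq_norm]; linarith)
        have h4 : bregman Ψ (w + v) u ≤ ε / 2 * ‖w + v - u‖ :=
          (le_abs_self _).trans h3
        nlinarith
    rw [mul_div_assoc, div_self h0.ne', mul_one] at this
    exact this.trans (le_add_of_nonneg_right (by positivity))
  · have h4 : ‖fderiv ℝ Ψ w - fderiv ℝ Ψ u‖ ≤ B + C * ‖u - w‖ := by
      refine (norm_sub_le _ _).trans ((add_le_add (hg w) (hg u)).trans ?_)
      have : ‖w‖ ≤ ‖u‖ + ‖u - w‖ := norm_le_norm_add_norm_sub u w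
      nlinarith
    rw [norm_sub_rev] at hw
    have h5 : 1 ≤ 2 / r * ‖u - w‖ := by
      rw [div_mul_eq_mul_div, le_div_iff₀ hr]; linarith
    have h6 : B + C * ‖u - w‖ ≤ (B * (2 / r) + C) * ‖u - w‖ := by nlinarith
    have h7 : (B * (2 / r) + C) * ‖u - w‖ ≤ (B * (2 / r) + C) * ‖u - w‖ * (2 / r * ‖u - w‖) :=
      le_mul_of_one_le_right (by positivity) h5
    nlinarith

/-- A convex function of at most quadratic growth has a gradient of at most linear growth. -/
theorem norm_fderiv_le_of_quadratic {C : ℝ} (hC : 0 < C) (hΨ0 : ∀ w, 0 ≤ Ψ w)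
    (hΨ : ∀ w, Ψ w ≤ C * ‖w‖ ^ 2) (h : ∀ u w, 0 ≤ bregman Ψ u w) (w : E) :
    ‖fderiv ℝ Ψ w‖ ≤ 4 * C * ‖w‖ := by
  -- The radius is kept separate from `‖w‖` because the sphere degenerates at `w = 0`; it tends to
  -- `‖w‖` at the end.
  have key : ∀ r : ℝ, 0 < r → ‖w‖ ≤ r → ‖fderiv ℝ Ψ w‖ ≤ 4 * C * r := by
    intro r hr hwr
    have := ContinuousLinearMap.norm_le_of_sphere (fderiv ℝ Ψ w) hr
      (B := 4 * C * r ^ 2) (by positivity) fun v hv => by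
        have h1 := h (w + v) w
        simp only [bregman, add_sub_cancel_left] at h1
        have h2 : ‖w + v‖ ≤ 2 * r := (norm_add_le _ _).trans (by linarith)
        have h3 : ‖w + v‖ ^ 2 ≤ (2 * r) ^ 2 := by gcongr
        have h4 := hΨ (w + v)
        have h5 := hΨ0 w
        nlinarith
    refine this.trans_eq ?_
    field_simp
  refine le_of_forall_pos_le_add fun ε hε => ?_
  have := key (‖w‖ + ε / (4 * C)) (by positivity) (by simp; positivity)
  refine this.trans_eq ?_
  field_simp

/-- A strongly convex function's argument is a continuous function of the gradient. -/
theorem IsStronglyConvex.exists_continuous_inverse [FiniteDimensional ℝ E]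
    (h : IsStronglyConvex Ψ σ) (hσ : 0 < σ) :
    ∃ G : StrongDual ℝ E → E, Continuous G ∧ ∀ w, G (fderiv ℝ Ψ w) = w := by
  classical
  have hinj : Function.Injective (fderiv ℝ Ψ) := fun u w huw => by
    have := h.norm_sub_le hσ u w
    rw [huw, sub_self, norm_zero, mul_zero] at this
    exact sub_eq_zero.1 (norm_le_zero_iff.1 this)
  -- The inverse is known only on the range of the gradient; being Lipschitz there, it extends to
  -- the whole dual since `E` is finite-dimensional.
  have hlip : LipschitzOnWith (Real.toNNReal σ⁻¹) (Function.invFun (fderiv ℝ Ψ))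
      (Set.range (fderiv ℝ Ψ)) := by
    refine LipschitzOnWith.of_dist_le_mul ?_
    rintro _ ⟨u, rfl⟩ _ ⟨w, rfl⟩
    rw [Function.leftInverse_invFun hinj, Function.leftInverse_invFun hinj, dist_eq_norm,
      dist_eq_norm, Real.coe_toNNReal _ (by positivity)]
    exact h.norm_sub_le hσ u w
  obtain ⟨G, hG, hGeq⟩ := hlip.extend_finite_dimension
  refine ⟨G, hG.continuous, fun w => ?_⟩
  rw [← hGeq ⟨w, rfl⟩, Function.leftInverse_invFun hinj]

end Bregman

/-! ### The divergence `Ψ_p`: gradient growth and strong convexity. -/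

section PNorm

/-- Tangent-line inequality with quadratic remainder for `|x|ᵖ`, `1 < p ≤ 2`. -/
theorem abs_rpow_tangent_quadratic {p M x y : ℝ} (hp1 : 1 < p) (hp2 : p ≤ 2) (hM : 0 < M)
    (hx : |x| ≤ M) (hy : |y| ≤ M) :
    |x| ^ p + p * |x| ^ (p - 2) * x * (y - x) + p * (p - 1) / 2 * M ^ (p - 2) * (y - x) ^ 2 ≤
      |y| ^ p := by
  -- As `p ≤ 2`, the second derivative `p (p - 1) |x| ^ (p - 2)` is at least `m` where `0 < |x| ≤
  -- M`, so `|x| ^ p - m / 2 * x ^ 2` is convex there. Its derivative is odd, so monotonicity is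
  -- checked on `[0, M]` and reflected, which avoids differentiating twice at `0`.
  set m := p * (p - 1) * M ^ (p - 2) with hm
  have hder : ∀ x : ℝ, HasDerivAt (fun x => |x| ^ p - m / 2 * x ^ 2)
      (p * |x| ^ (p - 2) * x - m * x) x := by
    intro x
    refine ((hasDerivAt_abs_rpow x hp1).sub
      ((hasDerivAt_pow 2 x).const_mul (m / 2))).congr_deriv ?_
    rw [Nat.cast_ofNat, Nat.add_one_sub_one, pow_one]
    ring
  have hpos : MonotoneOn (fun x : ℝ => p * x ^ (p - 1) - m * x) (Set.Icc 0 M) := by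
    refine monotoneOn_of_deriv_nonneg (convex_Icc _ _) ?_ ?_ ?_
    · refine ((continuousOn_const.mul ?_).sub (by fun_prop))
      exact continuousOn_id.rpow_const fun x _ => Or.inr (by linarith)
    · rw [interior_Icc]
      intro x hx
      have := ((Real.hasDerivAt_rpow_const (x := x) (p := p - 1) (Or.inl hx.1.ne')).const_mul p).sub
        ((hasDerivAt_id x).const_mul m)
      exact this.differentiableAt.differentiableWithinAt
    · rw [interior_Icc]
      intro x hx
      have := ((Real.hasDerivAt_rpow_const (x := x) (p := p - 1) (Or.inl hx.1.ne')).const_mul p).sub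
        ((hasDerivAt_id x).const_mul m)
      have h2 : deriv (fun x : ℝ => p * x ^ (p - 1) - m * x) x = _ := this.deriv
      rw [h2]
      have h3 : M ^ (p - 2) ≤ x ^ (p - 2) :=
        Real.rpow_le_rpow_of_nonpos hx.1 hx.2.le (by linarith)
      have h4 : p - 1 - 1 = p - 2 := by ring
      rw [h4, hm]
      have h5 : 0 ≤ p * (p - 1) := mul_nonneg (by linarith) (by linarith)
      nlinarith [mul_le_mul_of_nonneg_left h3 h5]
  have heq : ∀ x : ℝ, 0 ≤ x → p * |x| ^ (p - 2) * x - m * x = p * x ^ (p - 1) - m * x := by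
    intro x hx
    rcases hx.eq_or_lt with rfl | hx
    · simp [Real.zero_rpow (show p - 1 ≠ 0 by linarith)]
    · rw [abs_of_pos hx, mul_assoc p, ← Real.rpow_add_one hx.ne']
      ring_nf
  have hmono : MonotoneOn (fun x : ℝ => p * |x| ^ (p - 2) * x - m * x) (Set.Icc (-M) M) := by
    have hpos' : MonotoneOn (fun x : ℝ => p * |x| ^ (p - 2) * x - m * x) (Set.Icc 0 M) :=
      hpos.congr fun x hx => (heq x hx.1).symm
    have h0 : ∀ x ∈ Set.Icc 0 M, 0 ≤ p * |x| ^ (p - 2) * x - m * x := fun x hx => by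
      simpa using hpos' ⟨le_rfl, hM.le⟩ hx hx.1
    have hodd : ∀ x : ℝ, p * |(-x)| ^ (p - 2) * (-x) - m * (-x) =
      -(p * |x| ^ (p - 2) * x - m * x) := fun x => by rw [abs_neg]; ring
    intro x hx y hy hxy
    dsimp only
    rcases le_total 0 x with h | h
    · exact hpos' ⟨h, hx.2⟩ ⟨h.trans hxy, hy.2⟩ hxy
    · have hx' := hodd (-x)
      rw [neg_neg] at hx'
      rcases le_total 0 y with h' | h'
      · have h1 := h0 (-x) ⟨by linarith, by linarith [hx.1]⟩
        have h2 := h0 y ⟨h', hy.2⟩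
        linarith
      · have hy' := hodd (-y)
        rw [neg_neg] at hy'
        have := hpos' (a := -y) (b := -x) ⟨by linarith, by linarith [hy.1]⟩
          ⟨by linarith, by linarith [hx.1]⟩ (by linarith)
        dsimp only at this
        linarith
  have hconv : ConvexOn ℝ (Set.Icc (-M) M) (fun x => |x| ^ p - m / 2 * x ^ 2) := by
    have hd : Differentiable ℝ (fun x => |x| ^ p - m / 2 * x ^ 2) :=
      fun x => (hder x).differentiableAt
    refine MonotoneOn.convexOn_of_deriv (convex_Icc _ _) hd.continuous.continuousOn
      hd.differentiableOn ?_
    refine (hmono.mono interior_subset).congr fun x _ => (hder x).deriv.symm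
  have hx' := abs_le.1 hx
  have hy' := abs_le.1 hy
  have hgoal : (p * |x| ^ (p - 2) * x - m * x) * (y - x) ≤
      (|y| ^ p - m / 2 * y ^ 2) - (|x| ^ p - m / 2 * x ^ 2) := by
    rcases lt_trichotomy x y with h | h | h
    · have := hconv.le_slope_of_hasDerivAt hx' hy' h (hder x)
      rwa [slope_def_field, le_div_iff₀ (by linarith)] at this
    · subst h; simp
    · have := hconv.slope_le_of_hasDerivAt hy' hx' h (hder x)
      rw [slope_def_field, div_le_iff₀ (by linarith)] at this
      linarith
  nlinarith

/-- Tangent-line inequality for `s ↦ s ^ q`, `1 ≤ q`. -/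
theorem rpow_tangent_le {q s t : ℝ} (hq : 1 ≤ q) (hs : 0 < s) (ht : 0 ≤ t) :
    s ^ q + q * s ^ (q - 1) * (t - s) ≤ t ^ q := by
  have h := one_add_mul_self_le_rpow_one_add (s := t / s - 1) (p := q)
    (by have : 0 ≤ t / s := by positivity
        linarith) hq
  rw [add_sub_cancel, Real.div_rpow ht hs.le, le_div_iff₀ (by positivity)] at h
  have : s ^ q = s ^ (q - 1) * s := by rw [← Real.rpow_add_one hs.ne', sub_add_cancel]
  calc _ = (1 + q * (t / s - 1)) * s ^ q := by rw [this]; field_simp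
    _ ≤ _ := h

variable {d : ℕ} {E : Type*} [NormedAddCommGroup E] [NormedSpace ℝ E]
  (b : Module.Basis (Fin d) ℝ E) {p : ℝ}

/-- The `p`-th power sum of the coordinates. -/
noncomputable def powSum (p : ℝ) (w : E) : ℝ := ∑ i, |b.repr w i| ^ p

theorem powSum_nonneg (w : E) : 0 ≤ powSum b p w :=
  Finset.sum_nonneg fun _ _ => by positivity

theorem pNormDivergence_eq (w : E) :
    pNormDivergence b p w = 1 / 2 * powSum b p w ^ (2 / p) := by
  rw [pNormDivergence, pNorm, ← powSum, ← Real.rpow_natCast, ← Real.rpow_mul (powSum_nonneg b w)]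
  congr 2
  push_cast
  ring

theorem exists_repr_bounds :
    ∃ K : ℝ, 0 < K ∧ (∀ w i, |b.repr w i| ≤ K * ‖w‖) ∧
      ∀ w, ‖w‖ ^ 2 ≤ K ^ 2 * ∑ i, b.repr w i ^ 2 := by
  have : FiniteDimensional ℝ E := b.finiteDimensional_of_finite
  let e : E ≃L[ℝ] EuclideanSpace ℝ (Fin d) :=
    (b.equivFun.trans (WithLp.linearEquiv 2 ℝ (Fin d → ℝ)).symm).toContinuousLinearEquiv
  have he : ∀ w i, e w i = b.repr w i := fun w i => rfl
  refine ⟨1 + ‖(e : E →L[ℝ] EuclideanSpace ℝ (Fin d))‖ +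
    ‖(e.symm : EuclideanSpace ℝ (Fin d) →L[ℝ] E)‖, by positivity, fun w i => ?_, fun w => ?_⟩
  · rw [← he, ← Real.norm_eq_abs]
    refine (PiLp.norm_apply_le (e w) i).trans
      (((e : E →L[ℝ] EuclideanSpace ℝ (Fin d)).le_opNorm w).trans ?_)
    gcongr
    have := norm_nonneg (e.symm : EuclideanSpace ℝ (Fin d) →L[ℝ] E)
    linarith
  · have h1 := (e.symm : EuclideanSpace ℝ (Fin d) →L[ℝ] E).le_opNorm (e w)
    have h2 : ‖e w‖ ^ 2 = ∑ i, b.repr w i ^ 2 := by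
      rw [EuclideanSpace.real_norm_sq_eq]
      rfl
    rw [← h2, ← mul_pow]
    simp only [ContinuousLinearEquiv.coe_coe, ContinuousLinearEquiv.symm_apply_apply] at h1
    gcongr
    refine h1.trans ?_
    gcongr
    have := norm_nonneg (e : E →L[ℝ] EuclideanSpace ℝ (Fin d))
    linarith

theorem hasFDerivAt_powSum [FiniteDimensional ℝ E] (hp : 1 < p) (w : E) :
    HasFDerivAt (powSum b p)
      (∑ i, (p * |b.repr w i| ^ (p - 2) * b.repr w i) •
        LinearMap.toContinuousLinearMap (b.coord i)) w := by
  refine HasFDerivAt.fun_sum fun i _ => ?_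
  exact (hasDerivAt_abs_rpow (b.repr w i) hp).comp_hasFDerivAt w
    (LinearMap.toContinuousLinearMap (b.coord i)).hasFDerivAt

theorem hasFDerivAt_pNormDivergence [FiniteDimensional ℝ E] (hp1 : 1 < p) (hp2 : p ≤ 2) (w : E) :
    HasFDerivAt (pNormDivergence b p)
      (((1 / p) * powSum b p w ^ (2 / p - 1)) •
        ∑ i, (p * |b.repr w i| ^ (p - 2) * b.repr w i) •
          LinearMap.toContinuousLinearMap (b.coord i)) w := by
  have h2 : 1 ≤ 2 / p := by rw [le_div_iff₀ (by linarith)]; linarith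
  have := ((hasFDerivAt_powSum b hp1 w).rpow_const (p := 2 / p) (Or.inr h2)).const_mul (1 / 2)
  rw [smul_smul] at this
  rw [show pNormDivergence b p = fun y => 1 / 2 * powSum b p y ^ (2 / p) from
    funext fun v => pNormDivergence_eq b v]
  refine this.congr_fderiv ?_
  congr 1
  ring

theorem exists_pNormDivergence_bounds (hp1 : 1 < p) :
    ∃ c C : ℝ, 0 < c ∧ 0 < C ∧
      ∀ w, c * ‖w‖ ^ 2 ≤ pNormDivergence b p w ∧ pNormDivergence b p w ≤ C * ‖w‖ ^ 2 := by
  obtain ⟨K, hK, hK1, hK2⟩ := exists_repr_bounds b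
  have hp0 : 0 < p := by linarith
  refine ⟨1 / (2 * (K ^ 2 * (d + 1))), 1 / 2 * ((d + 1 : ℝ) ^ (2 / p) * K ^ 2), by positivity,
    by positivity, fun w => ⟨?_, ?_⟩⟩
  · rw [pNormDivergence_eq]
    have h1 : ∀ i, b.repr w i ^ 2 ≤ powSum b p w ^ (2 / p) := by
      intro i
      have h2 : |b.repr w i| ^ p ≤ powSum b p w :=
        Finset.single_le_sum (f := fun i => |b.repr w i| ^ p) (fun _ _ => by positivity)
          (Finset.mem_univ i)
      calc b.repr w i ^ 2 = (|b.repr w i| ^ p) ^ (2 / p) := by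
            rw [← Real.rpow_mul (abs_nonneg _), mul_div_cancel₀ _ hp0.ne']
            norm_num
        _ ≤ _ := Real.rpow_le_rpow (by positivity) h2 (by positivity)
    have h3 : ∑ i, b.repr w i ^ 2 ≤ d * powSum b p w ^ (2 / p) := by
      simpa using Finset.sum_le_card_nsmul Finset.univ _ _ fun i _ => h1 i
    have h4 := hK2 w
    have h5 : 0 ≤ powSum b p w ^ (2 / p) := Real.rpow_nonneg (powSum_nonneg b w) _
    rw [div_mul_eq_mul_div, div_le_iff₀ (by positivity)]
    have h6 : K ^ 2 * ∑ i, b.repr w i ^ 2 ≤ K ^ 2 * (d * powSum b p w ^ (2 / p)) := by gcongr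
    have h7 : 0 ≤ K ^ 2 * powSum b p w ^ (2 / p) := by positivity
    nlinarith
  · rw [pNormDivergence_eq]
    have h1 : powSum b p w ≤ (d + 1) * (K * ‖w‖) ^ p := by
      have h2 : powSum b p w ≤ d * (K * ‖w‖) ^ p := by
        simpa [powSum] using Finset.sum_le_card_nsmul Finset.univ (fun i => |b.repr w i| ^ p)
          ((K * ‖w‖) ^ p) fun i _ => Real.rpow_le_rpow (abs_nonneg _) (hK1 w i) hp0.le
      have : 0 ≤ (K * ‖w‖) ^ p := by positivity
      linarith
    have h3 := Real.rpow_le_rpow (powSum_nonneg b w) h1 (show 0 ≤ 2 / p by positivity)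
    rw [Real.mul_rpow (by positivity) (by positivity), ← Real.rpow_mul (by positivity),
      mul_div_cancel₀ _ hp0.ne'] at h3
    have h4 : (K * ‖w‖) ^ (2 : ℝ) = K ^ 2 * ‖w‖ ^ 2 := by rw [Real.rpow_two, mul_pow]
    rw [h4] at h3
    linarith

/-- `Ψ_p` is half of `s ↦ s ^ (2 / p)` composed with the power sum. The convex outer function
contributes its tangent line, and the quadratic remainder comes from the coordinatewise bound on
`|x| ^ p`. -/
theorem bregman_pNormDivergence_ge (hp1 : 1 < p) (hp2 : p ≤ 2) {M : ℝ} (hM : 0 < M) {u w : E}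
    (hu : ∀ i, |b.repr u i| ≤ M) (hw : ∀ i, |b.repr w i| ≤ M) (hw0 : 0 < powSum b p w) :
    (p - 1) / 2 * (powSum b p w ^ (2 / p - 1) * M ^ (p - 2)) * ∑ i, b.repr (u - w) i ^ 2 ≤
      bregman (pNormDivergence b p) u w := by
  have : FiniteDimensional ℝ E := b.finiteDimensional_of_finite
  have hp0 : 0 < p := by linarith
  have h2 : 1 ≤ 2 / p := by rw [le_div_iff₀ (by linarith)]; linarith
  rw [bregman, (hasFDerivAt_pNormDivergence b hp1 hp2 w).fderiv, pNormDivergence_eq,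
    pNormDivergence_eq]
  have h3 := rpow_tangent_le h2 hw0 (powSum_nonneg b (p := p) u)
  have h4 : powSum b p w + ∑ i, p * |b.repr w i| ^ (p - 2) * b.repr w i * b.repr (u - w) i +
      p * (p - 1) / 2 * M ^ (p - 2) * ∑ i, b.repr (u - w) i ^ 2 ≤ powSum b p u := by
    rw [powSum, powSum, Finset.mul_sum, ← Finset.sum_add_distrib, ← Finset.sum_add_distrib]
    refine Finset.sum_le_sum fun i _ => ?_
    have := abs_rpow_tangent_quadratic hp1 hp2 hM (hw i) (hu i)
    simpa using this
  simp only [smul_apply, sum_apply, smul_eq_mul,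
    LinearMap.coe_toContinuousLinearMap', Module.Basis.coord_apply]
  set S' := ∑ i, p * |b.repr w i| ^ (p - 2) * b.repr w i * b.repr (u - w) i
  set Q := ∑ i, b.repr (u - w) i ^ 2
  set s := powSum b p w ^ (2 / p - 1)
  have hs : 0 ≤ s := Real.rpow_nonneg hw0.le _
  have h5 : 1 / p * s * (S' + p * (p - 1) / 2 * M ^ (p - 2) * Q) ≤
      1 / p * s * (powSum b p u - powSum b p w) :=
    mul_le_mul_of_nonneg_left (by linarith) (by positivity)
  have h6 : 1 / p * s * (S' + p * (p - 1) / 2 * M ^ (p - 2) * Q) =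
      1 / p * s * S' + (p - 1) / 2 * (s * M ^ (p - 2)) * Q := by field_simp
  have h7 : 2 / p * s * (powSum b p u - powSum b p w) =
    2 * (1 / p * s * (powSum b p u - powSum b p w)) := by ring
  linarith

theorem bregman_pNormDivergence_zero (hp1 : 1 < p) (hp2 : p ≤ 2) (u : E) :
    bregman (pNormDivergence b p) u 0 = pNormDivergence b p u := by
  have : FiniteDimensional ℝ E := b.finiteDimensional_of_finite
  have hp0 : p ≠ 0 := by linarith
  rw [bregman, (hasFDerivAt_pNormDivergence b hp1 hp2 0).fderiv, pNormDivergence_eq b 0]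
  simp [powSum, Real.zero_rpow hp0, Real.zero_rpow (div_ne_zero two_ne_zero hp0)]

theorem differentiable_pNormDivergence (hp1 : 1 < p) (hp2 : p ≤ 2) :
    Differentiable ℝ (pNormDivergence b p) := by
  have : FiniteDimensional ℝ E := b.finiteDimensional_of_finite
  exact fun w => (hasFDerivAt_pNormDivergence b hp1 hp2 w).differentiableAt

theorem powSum_pos_of_ne_zero (hp1 : 1 < p) {w : E} (hw : w ≠ 0) : 0 < powSum b p w := by
  refine (powSum_nonneg b w).lt_of_ne fun h => ?_
  obtain ⟨c, C, hc, -, hcC⟩ := exists_pNormDivergence_bounds b hp1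
  have h1 := (hcC w).1
  rw [pNormDivergence_eq, ← h, Real.zero_rpow (by positivity)] at h1
  have := norm_pos_iff.2 hw
  have : 0 < c * ‖w‖ ^ 2 := by positivity
  linarith

theorem bregman_pNormDivergence_nonneg (hp1 : 1 < p) (hp2 : p ≤ 2) (u w : E) :
    0 ≤ bregman (pNormDivergence b p) u w := by
  obtain ⟨K, hK, hK1, -⟩ := exists_repr_bounds b
  rcases eq_or_ne w 0 with rfl | hw
  · rw [bregman_pNormDivergence_zero b hp1 hp2, pNormDivergence]
    positivity
  · have hw' := norm_pos_iff.2 hw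
    refine le_trans ?_ (bregman_pNormDivergence_ge b hp1 hp2 (M := K * (‖u‖ + ‖w‖))
      (by positivity) (fun i => (hK1 u i).trans ?_) (fun i => (hK1 w i).trans ?_)
      (powSum_pos_of_ne_zero b hp1 hw))
    · have h1 : 0 ≤ powSum b p w ^ (2 / p - 1) := Real.rpow_nonneg (powSum_nonneg b w) _
      have h2 : 0 ≤ (p - 1) / 2 := by linarith
      positivity
    · gcongr; linarith
    · gcongr; linarith [norm_nonneg u]

theorem hasLinearGradGrowth_pNormDivergence (hp1 : 1 < p) (hp2 : p ≤ 2) :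
    HasLinearGradGrowth (pNormDivergence b p) := by
  obtain ⟨c, C, hc, hC, hcC⟩ := exists_pNormDivergence_bounds b hp1
  refine ⟨4 * C, by positivity, fun w => ?_⟩
  refine (norm_fderiv_le_of_quadratic hC (fun w => le_trans (by positivity) (hcC w).1)
    (fun w => (hcC w).2) (bregman_pNormDivergence_nonneg b hp1 hp2) w).trans ?_
  gcongr
  linarith

/-- `Ψ_p` is strongly convex with respect to any norm, for some modulus. -/
theorem exists_isStronglyConvex_pNormDivergence (hp1 : 1 < p) (hp2 : p ≤ 2) :
    ∃ σ : ℝ, 0 < σ ∧ IsStronglyConvex (pNormDivergence b p) σ := by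
  have hp0 : 0 < p := by linarith
  obtain ⟨c, C, hc, hC, hcC⟩ := exists_pNormDivergence_bounds b hp1
  obtain ⟨K, hK, hK1, hK2⟩ := exists_repr_bounds b
  have hgrad := norm_fderiv_le_of_quadratic hC (fun w => le_trans (by positivity) (hcC w).1)
    (fun w => (hcC w).2) (bregman_pNormDivergence_nonneg b hp1 hp2)
  -- If `‖w‖ < r ‖u - w‖`, then `‖u‖ ≥ ‖u - w‖ / 2` and `Ψ u` contributes `c / 4`. The terms in `w`
  -- cost at most `5 r C ≤ c / 8` (`1` from the value, `4` from the gradient), leaving `c / 8`.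
  set r := min (1 / 2) (c / (40 * C)) with hr
  have hr0 : 0 < r := by positivity
  have hr2 : r ≤ 1 / 2 := min_le_left _ _
  have hrC : r * C ≤ c / 40 := by
    calc r * C ≤ c / (40 * C) * C := by gcongr; exact min_le_right _ _
      _ = c / 40 := by field_simp
  -- In the other regime `M = K (1 + 1 / r) ‖w‖` bounds all coordinates of `u` and `w`, and `2 Ψ_p w
  -- ≥ y M²`. The factor `powSum ^ (2 / p - 1) * M ^ (p - 2)` is invariant under scaling and is then
  -- at least `y ^ ((2 - p) / 2)`.
  set y := 2 * c / (K * (1 + 1 / r)) ^ 2 with hy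
  have hy0 : 0 < y := by positivity
  set q := (p - 1) / 2 * y ^ ((2 - p) / 2) / K ^ 2 with hq
  have hq0 : 0 < q := by
    have : 0 < (p - 1) / 2 := by linarith
    positivity
  refine ⟨2 * min q (c / 8), by positivity, fun u w => ?_⟩
  rw [mul_div_cancel_left₀ _ (two_ne_zero)]
  rcases lt_or_ge ‖w‖ (r * ‖u - w‖) with h | h
  · refine le_trans (mul_le_mul_of_nonneg_right (min_le_right _ _) (by positivity)) ?_
    have h0 := norm_nonneg w
    have h1 := (le_abs_self _).trans ((fderiv ℝ (pNormDivergence b p) w).le_opNorm (u - w))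
    have h2 := (hcC u).1
    have h3 := (hcC w).2
    have h4 := mul_le_mul_of_nonneg_right (hgrad w) (norm_nonneg (u - w))
    have h5 : 1 / 2 * ‖u - w‖ ≤ ‖u‖ := by
      have := norm_sub_le u w
      nlinarith [norm_nonneg (u - w)]
    have h6 : (1 / 2 * ‖u - w‖) ^ 2 ≤ ‖u‖ ^ 2 := by gcongr
    have h7 : ‖w‖ * ‖u - w‖ ≤ r * ‖u - w‖ ^ 2 := by nlinarith [norm_nonneg (u - w)]
    have h8 : ‖w‖ ^ 2 ≤ r * ‖u - w‖ ^ 2 := by nlinarith [norm_nonneg (u - w)]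
    have h9 : C * ‖w‖ ^ 2 ≤ C * (r * ‖u - w‖ ^ 2) := by gcongr
    have h10 : C * (‖w‖ * ‖u - w‖) ≤ C * (r * ‖u - w‖ ^ 2) := by gcongr
    have h11 : r * C * ‖u - w‖ ^ 2 ≤ c / 40 * ‖u - w‖ ^ 2 := by gcongr
    have h12 : c * (1 / 2 * ‖u - w‖) ^ 2 ≤ c * ‖u‖ ^ 2 := by gcongr
    rw [bregman]
    nlinarith
  · refine le_trans (mul_le_mul_of_nonneg_right (min_le_left _ _) (by positivity)) ?_
    rcases eq_or_ne w 0 with rfl | hw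
    · have : u = 0 := by
        rw [norm_zero, sub_zero] at h
        exact norm_le_zero_iff.1 (nonpos_of_mul_nonpos_right h hr0)
      simp [this]
    have hw' := norm_pos_iff.2 hw
    set M := K * (1 + 1 / r) * ‖w‖ with hM
    have hM0 : 0 < M := by positivity
    have huw : ‖u - w‖ ≤ 1 / r * ‖w‖ := by
      rw [one_div, inv_mul_eq_div, le_div_iff₀ hr0]; linarith
    have hun : ‖u‖ ≤ (1 + 1 / r) * ‖w‖ := by
      have := norm_le_norm_sub_add u w
      linarith
    refine le_trans ?_ (bregman_pNormDivergence_ge b hp1 hp2 hM0 (fun i => (hK1 u i).trans ?_)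
      (fun i => (hK1 w i).trans ?_) (powSum_pos_of_ne_zero b hp1 hw))
    · have h1 : y ^ ((2 - p) / 2) ≤ powSum b p w ^ (2 / p - 1) * M ^ (p - 2) := by
        have h2 : y * M ^ 2 ≤ powSum b p w ^ (2 / p) := by
          have h3 := (hcC w).1
          rw [pNormDivergence_eq] at h3
          have h4 : y * M ^ 2 = 2 * (c * ‖w‖ ^ 2) := by rw [hy, hM]; field_simp
          linarith
        have h5 := Real.rpow_le_rpow (by positivity) h2 (show 0 ≤ (2 - p) / 2 by linarith)
        rw [Real.mul_rpow hy0.le (by positivity), ← Real.rpow_mul (powSum_nonneg b w),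
          ← Real.rpow_natCast, ← Real.rpow_mul hM0.le] at h5
        have h6 : 2 / p * ((2 - p) / 2) = 2 / p - 1 := by field_simp
        have h7 : ((2 : ℕ) : ℝ) * ((2 - p) / 2) = 2 - p := by push_cast; ring
        have h8 : M ^ (p - 2) = (M ^ (2 - p))⁻¹ := by
          rw [← Real.rpow_neg hM0.le]; congr 1; ring
        rw [h6, h7] at h5
        rwa [h8, ← div_eq_mul_inv, le_div_iff₀ (by positivity)]
      have h2 := hK2 (u - w)
      have h3 : q * ‖u - w‖ ^ 2 ≤ q * (K ^ 2 * ∑ i, b.repr (u - w) i ^ 2) := by gcongr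
      have h4 : q * (K ^ 2 * ∑ i, b.repr (u - w) i ^ 2) =
          (p - 1) / 2 * y ^ ((2 - p) / 2) * ∑ i, b.repr (u - w) i ^ 2 := by
        rw [hq]; field_simp
      refine h3.trans (h4.trans_le ?_)
      have h5 : 0 ≤ (p - 1) / 2 := by linarith
      gcongr
    · rw [hM, mul_assoc]; gcongr
    · rw [hM, mul_assoc]; gcongr
      refine le_mul_of_one_le_left (norm_nonneg _) ?_
      have : 0 < 1 / r := by positivity
      linarith

end PNorm

/-! ### Past samples and integrating out the current one. -/

section History

variable {𝒵 Ω : Type*} [MeasurableSpace 𝒵]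

/-- The `σ`-algebra generated by the samples `z 1, …, z (t - 1)`. -/
abbrev sampleHist (z : ℕ → Ω → 𝒵) (t : ℕ) : MeasurableSpace Ω :=
  ⨆ s ∈ {s : ℕ | s + 1 < t}, MeasurableSpace.comap (z (s + 1)) inferInstance

theorem sampleHist_mono (z : ℕ → Ω → 𝒵) : Monotone (sampleHist z) := fun _ _ h =>
  biSup_mono fun _ hs => lt_of_lt_of_le hs h

theorem measurable_sampleHist (z : ℕ → Ω → 𝒵) {t : ℕ} (ht : 1 ≤ t) :
    Measurable[sampleHist z (t + 1)] (z t) := by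
  obtain ⟨s, rfl⟩ : ∃ s, t = s + 1 := ⟨t - 1, by omega⟩
  have : MeasurableSpace.comap (z (s + 1)) inferInstance ≤ sampleHist z (s + 1 + 1) :=
    le_iSup₂_of_le (f := fun (s : ℕ) (_ : s ∈ {r : ℕ | r + 1 < _}) =>
      MeasurableSpace.comap (z (s + 1)) inferInstance) s (Nat.lt_succ_self _) le_rfl
  exact Measurable.of_comap_le this

variable [mΩ : MeasurableSpace Ω] {P : Measure Ω} {z : ℕ → Ω → 𝒵}

theorem sampleHist_le (hz : ∀ t, 1 ≤ t → Measurable (z t)) (t : ℕ) : sampleHist z t ≤ mΩ :=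
  iSup₂_le fun s _ => (hz (s + 1) (by omega)).comap_le

theorem indep_sampleHist (hz : ∀ t, 1 ≤ t → Measurable (z t))
    (hind : iIndepFun (fun t : ℕ => z (t + 1)) P) {t : ℕ} (ht : 1 ≤ t) :
    Indep (sampleHist z t) (MeasurableSpace.comap (z t) inferInstance) P := by
  obtain ⟨s, rfl⟩ : ∃ s, t = s + 1 := ⟨t - 1, by omega⟩
  have := indep_iSup_of_disjoint (fun i => (hz (i + 1) (by omega)).comap_le) hind
    (S := {r : ℕ | r + 1 < s + 1}) (T := {s}) (by simp)
  simpa [sampleHist] using this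

variable {E : Type*} [MeasurableSpace E] {ρ : Measure 𝒵}

/-- Restricting `P` to a past event keeps the current sample independent of `W` with law `ρ`, as is
checked on rectangles. Working with such restrictions replaces conditional expectations and is the
form the submartingale criterion requires. -/
theorem map_restrict_sampleHist [IsProbabilityMeasure ρ] [IsProbabilityMeasure P]
    (hz : ∀ t, 1 ≤ t → Measurable (z t))
    (hlaw : ∀ t, 1 ≤ t → P.map (z t) = ρ)
    (hind : iIndepFun (fun t : ℕ => z (t + 1)) P) {t : ℕ} (ht : 1 ≤ t) {W : Ω → E}
    (hW : Measurable[sampleHist z t] W) {s : Set Ω} (hs : MeasurableSet[sampleHist z t] s) :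
    (P.restrict s).map (fun ω => (W ω, z t ω)) = ((P.restrict s).map W).prod ρ := by
  have hWm : Measurable W := hW.mono (sampleHist_le hz t) le_rfl
  symm
  refine Measure.prod_eq fun A B hA hB => ?_
  rw [Measure.map_apply (hWm.prodMk (hz t ht)) (hA.prod hB),
    Measure.map_apply hWm hA, Measure.restrict_apply (hWm hA),
    Measure.restrict_apply ((hWm.prodMk (hz t ht)) (hA.prod hB)), ← hlaw t ht,
    Measure.map_apply (hz t ht) hB]
  have := (Indep_iff _ _ P).1 (indep_sampleHist hz hind ht) (W ⁻¹' A ∩ s) (z t ⁻¹' B)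
    ((hW hA).inter hs) ⟨B, hB, rfl⟩
  rw [← this]
  congr 1
  ext ω
  simp only [Set.mem_inter_iff, Set.mem_preimage, Set.mem_prod]
  tauto

/-- Freezing: the current sample may be integrated out conditionally on the history. -/
theorem setIntegral_sampleHist [IsProbabilityMeasure ρ] [IsProbabilityMeasure P]
    (hz : ∀ t, 1 ≤ t → Measurable (z t))
    (hlaw : ∀ t, 1 ≤ t → P.map (z t) = ρ)
    (hind : iIndepFun (fun t : ℕ => z (t + 1)) P) {t : ℕ} (ht : 1 ≤ t) {W : Ω → E}
    (hW : Measurable[sampleHist z t] W) {F : E × 𝒵 → ℝ} (hF : Measurable F)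
    (hint : Integrable (fun ω => F (W ω, z t ω)) P) {s : Set Ω}
    (hs : MeasurableSet[sampleHist z t] s) :
    Integrable (fun ω => ∫ a, F (W ω, a) ∂ρ) P ∧
      ∫ ω in s, F (W ω, z t ω) ∂P = ∫ ω in s, ∫ a, F (W ω, a) ∂ρ ∂P := by
  have hWm : Measurable W := hW.mono (sampleHist_le hz t) le_rfl
  have hm : ∀ μ : Measure Ω, AEMeasurable (fun ω => (W ω, z t ω)) μ :=
    fun μ => (hWm.prodMk (hz t ht)).aemeasurable
  have hfull := map_restrict_sampleHist hz hlaw hind ht hW MeasurableSet.univ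
  have hset := map_restrict_sampleHist hz hlaw hind ht hW hs
  rw [Measure.restrict_univ] at hfull
  have h1 : Integrable F ((P.map W).prod ρ) := by
    rw [← hfull, integrable_map_measure hF.aestronglyMeasurable (hm _)]
    exact hint
  have h2 : Integrable F (((P.restrict s).map W).prod ρ) := by
    rw [← hset, integrable_map_measure hF.aestronglyMeasurable (hm _)]
    exact hint.restrict
  refine ⟨h1.integral_prod_left.comp_measurable hWm, ?_⟩
  calc ∫ ω in s, F (W ω, z t ω) ∂P
      = ∫ x, F x ∂((P.restrict s).map (fun ω => (W ω, z t ω))) :=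
        (integral_map (hm _) hF.aestronglyMeasurable).symm
    _ = ∫ v, ∫ a, F (v, a) ∂ρ ∂((P.restrict s).map W) := by rw [hset, integral_prod _ h2]
    _ = _ := integral_map hWm.aemeasurable h2.integral_prod_left.aestronglyMeasurable

end History

/-! ### One step of mirror descent, in mean and on past events. -/

section Run

variable {E : Type*} [NormedAddCommGroup E] [NormedSpace ℝ E]

theorem bregman_step {Ψ : E → ℝ} {u w v : E} {c : ℝ} {x : StrongDual ℝ E}
    (h : fderiv ℝ Ψ v = fderiv ℝ Ψ w - c • x) :
    bregman Ψ u v = bregman Ψ u w + c * x (u - w) + bregman Ψ w v := by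
  rw [bregman_three_point u w v, h]
  simp
  ring

variable [MeasurableSpace E] {𝒵 Ω : Type*} [MeasurableSpace 𝒵] [mΩ : MeasurableSpace Ω]

/-- The mean squared excess residual `E ⟨w - u, X⟩²`. -/
noncomputable def excessRisk (X : 𝒵 → StrongDual ℝ E) (ρ : Measure 𝒵) (u w : E) : ℝ :=
  ∫ a, X a (w - u) ^ 2 ∂ρ

/-- Least-squares mirror descent on independent samples, with a target `u` that solves the
normal equations. -/
structure IsSampledOMD (Ψ : E → ℝ) (X : 𝒵 → StrongDual ℝ E) (Y : 𝒵 → ℝ) (ρ : Measure 𝒵)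
    (P : Measure Ω) (η : ℕ → ℝ) (z : ℕ → Ω → 𝒵) (w : ℕ → Ω → E) (w₁ u : E) (R : ℝ) : Prop where
  differentiable : Differentiable ℝ Ψ
  growth : HasLinearGradGrowth Ψ
  exists_convex : ∃ σ : ℝ, 0 < σ ∧ IsStronglyConvex Ψ σ
  measurable_X : Measurable X
  measurable_Y : Measurable Y
  norm_X_le : ∀ a, ‖X a‖ ≤ R
  memLp_Y : MemLp Y 2 ρ
  measurable_z : ∀ t, 1 ≤ t → Measurable (z t)
  map_z : ∀ t, 1 ≤ t → P.map (z t) = ρ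
  indep : iIndepFun (fun t : ℕ => z (t + 1)) P
  step_pos : ∀ t, 1 ≤ t → 0 < η t
  init : ∀ ω, w 1 ω = w₁
  step : ∀ t, 1 ≤ t → ∀ ω, fderiv ℝ Ψ (w (t + 1) ω) =
    fderiv ℝ Ψ (w t ω) - (η t * (X (z t ω) (w t ω) - Y (z t ω))) • X (z t ω)
  normal : ∀ v, ∫ a, (X a u - Y a) * X a v ∂ρ = 0

namespace IsSampledOMD

set_option linter.unusedSectionVars false

variable [BorelSpace E] [FiniteDimensional ℝ E]
  {Ψ : E → ℝ} {X : 𝒵 → StrongDual ℝ E} {Y : 𝒵 → ℝ} {ρ : Measure 𝒵} [IsProbabilityMeasure ρ]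
  {P : Measure Ω} [IsProbabilityMeasure P] {η : ℕ → ℝ} {z : ℕ → Ω → 𝒵} {w : ℕ → Ω → E}
  {w₁ u : E} {R : ℝ}

theorem R_nonneg (h : IsSampledOMD Ψ X Y ρ P η z w w₁ u R) : 0 ≤ R := by
  have : Nonempty 𝒵 := by
    by_contra hne
    rw [not_nonempty_iff] at hne
    exact IsProbabilityMeasure.ne_zero ρ (Measure.eq_zero_of_isEmpty ρ)
  exact (norm_nonneg _).trans (h.norm_X_le (Classical.arbitrary 𝒵))

theorem measurable_apply (h : IsSampledOMD Ψ X Y ρ P η z w w₁ u R)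
    {Ω' : Type*} [MeasurableSpace Ω'] {W : Ω' → E} {Z : Ω' → 𝒵} (hW : Measurable W)
    (hZ : Measurable Z) : Measurable fun ω => X (Z ω) (W ω) :=
  Continuous.measurable2 (c := fun (x : StrongDual ℝ E) (v : E) => x v)
    (continuous_fst.clm_apply continuous_snd) (h.measurable_X.comp hZ) hW

/-- The recursion fixes only the gradient of the next iterate. A continuous left inverse of the
gradient turns it into a measurable function of `(w t, z t)`. -/
theorem measurable_hist (h : IsSampledOMD Ψ X Y ρ P η z w w₁ u R) {t : ℕ} (ht : 1 ≤ t) :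
    Measurable[sampleHist z t] (w t) := by
  obtain ⟨σ, hσ, hconv⟩ := h.exists_convex
  obtain ⟨G, hG, hGi⟩ := hconv.exists_continuous_inverse hσ
  induction t, ht using Nat.le_induction with
  | base =>
    rw [show w 1 = fun _ => w₁ from funext h.init]
    exact measurable_const
  | succ t ht ih =>
    have hstep : Measurable fun q : E × 𝒵 => G (fderiv ℝ Ψ q.1 -
        (η t * (X q.2 q.1 - Y q.2)) • X q.2) := by
      refine hG.measurable.comp (((measurable_fderiv ℝ Ψ).comp measurable_fst).sub ?_)
      exact (((h.measurable_apply measurable_fst measurable_snd).sub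
        (h.measurable_Y.comp measurable_snd)).const_mul _).smul
        (h.measurable_X.comp measurable_snd)
    have hw : w (t + 1) = (fun q : E × 𝒵 => G (fderiv ℝ Ψ q.1 -
        (η t * (X q.2 q.1 - Y q.2)) • X q.2)) ∘ fun ω => (w t ω, z t ω) :=
      funext fun ω => by simp only [Function.comp_apply]; rw [← h.step t ht, hGi]
    rw [hw]
    exact hstep.comp ((ih.mono (sampleHist_mono z (Nat.le_succ t)) le_rfl).prodMk
      (measurable_sampleHist z ht))

theorem measurable_iterate (h : IsSampledOMD Ψ X Y ρ P η z w w₁ u R) {t : ℕ} (ht : 1 ≤ t) :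
    Measurable (w t) :=
  (h.measurable_hist ht).mono (sampleHist_le h.measurable_z t) le_rfl

theorem memLp_Y_sample (h : IsSampledOMD Ψ X Y ρ P η z w w₁ u R) {t : ℕ} (ht : 1 ≤ t) :
    MemLp (fun ω => Y (z t ω)) 2 P :=
  (h.memLp_Y.comp_measurePreserving ⟨h.measurable_z t ht, h.map_z t ht⟩)

theorem memLp_apply (h : IsSampledOMD Ψ X Y ρ P η z w w₁ u R) {t : ℕ} (ht : 1 ≤ t)
    {W : Ω → E} (hW : Measurable W) (hW2 : MemLp W 2 P) :
    MemLp (fun ω => X (z t ω) (W ω)) 2 P :=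
  hW2.of_le_mul (c := R)
    (h.measurable_apply hW (h.measurable_z t ht)).aestronglyMeasurable
    (Eventually.of_forall fun ω => ((X (z t ω)).le_opNorm _).trans (by
      gcongr; exact h.norm_X_le _))

/-- The increment is at most `σ⁻¹ η R` times the residual, which is square integrable by induction.
-/
theorem memLp_iterate (h : IsSampledOMD Ψ X Y ρ P η z w w₁ u R) {t : ℕ} (ht : 1 ≤ t) :
    MemLp (w t) 2 P := by
  obtain ⟨σ, hσ, hconv⟩ := h.exists_convex
  induction t, ht using Nat.le_induction with
  | base =>
    rw [show w 1 = fun _ => w₁ from funext h.init]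
    exact memLp_const _
  | succ t ht ih =>
    have hres : MemLp (fun ω => X (z t ω) (w t ω) - Y (z t ω)) 2 P :=
      (h.memLp_apply ht (h.measurable_iterate ht) ih).sub (h.memLp_Y_sample ht)
    have hdiff : MemLp (fun ω => w (t + 1) ω - w t ω) 2 P := by
      refine hres.of_le_mul (c := σ⁻¹ * (η t * R))
        ((h.measurable_iterate (by omega)).sub (h.measurable_iterate ht)).aestronglyMeasurable
        (Eventually.of_forall fun ω => (hconv.norm_sub_le hσ _ _).trans ?_)
      have h1 : fderiv ℝ Ψ (w (t + 1) ω) - fderiv ℝ Ψ (w t ω) =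
          -((η t * (X (z t ω) (w t ω) - Y (z t ω))) • X (z t ω)) := by
        rw [h.step t ht]; abel
      rw [h1, norm_neg, norm_smul, norm_mul, Real.norm_of_nonneg (h.step_pos t ht).le, mul_assoc,
        mul_assoc, mul_assoc, mul_comm ‖X (z t ω) (w t ω) - Y (z t ω)‖]
      have := h.step_pos t ht
      gcongr
      exact h.norm_X_le _
    have : w (t + 1) = fun ω => (w (t + 1) ω - w t ω) + w t ω := by ext ω; simp
    rw [this]
    exact hdiff.add ih

theorem memLp_residual (h : IsSampledOMD Ψ X Y ρ P η z w w₁ u R) {t : ℕ} (ht : 1 ≤ t) :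
    MemLp (fun ω => X (z t ω) (w t ω) - Y (z t ω)) 2 P :=
  (h.memLp_apply ht (h.measurable_iterate ht) (h.memLp_iterate ht)).sub (h.memLp_Y_sample ht)

theorem memLp_error (h : IsSampledOMD Ψ X Y ρ P η z w w₁ u R) {t : ℕ} (ht : 1 ≤ t) :
    MemLp (fun ω => u - w t ω) 2 P :=
  (memLp_const u).sub (h.memLp_iterate ht)

theorem integrable_error (h : IsSampledOMD Ψ X Y ρ P η z w w₁ u R) {t : ℕ} (ht : 1 ≤ t) :
    Integrable (fun ω => ‖u - w t ω‖ ^ 2) P :=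
  (h.memLp_error ht).integrable_norm_pow two_ne_zero

theorem measurable_bregman (h : IsSampledOMD Ψ X Y ρ P η z w w₁ u R) :
    Measurable fun v : E => bregman Ψ u v := by
  have h1 : Measurable fun v : E => fderiv ℝ Ψ v (u - v) :=
    Continuous.measurable2 (c := fun (x : StrongDual ℝ E) (v : E) => x v)
      (continuous_fst.clm_apply continuous_snd) (measurable_fderiv ℝ Ψ)
      (measurable_const.sub measurable_id)
  exact (measurable_const.sub h.differentiable.continuous.measurable).sub h1

theorem integrable_bregman (h : IsSampledOMD Ψ X Y ρ P η z w w₁ u R) {t : ℕ} (ht : 1 ≤ t) :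
    Integrable (fun ω => bregman Ψ u (w t ω)) P := by
  obtain ⟨σ, hσ, hconv⟩ := h.exists_convex
  obtain ⟨C, hC, hbound⟩ := h.growth.bregman_le hconv hσ u one_pos
  refine ((integrable_const (1 : ℝ)).add ((h.integrable_error ht).const_mul C)).mono'
    (h.measurable_bregman.comp (h.measurable_iterate ht)).aestronglyMeasurable
    (Eventually.of_forall fun ω => ?_)
  rw [Real.norm_of_nonneg (hconv.bregman_nonneg hσ _ _)]
  exact hbound _

theorem memLp_X (h : IsSampledOMD Ψ X Y ρ P η z w w₁ u R) (v : E) :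
    MemLp (fun a => X a v) 2 ρ := by
  refine MemLp.of_bound (h.measurable_apply measurable_const measurable_id).aestronglyMeasurable
    (R * ‖v‖) (Eventually.of_forall fun a => ((X a).le_opNorm v).trans ?_)
  gcongr
  exact h.norm_X_le a

/-- Splitting the residual at `u`, the noise part integrates to zero by the normal equations and
only a square survives. -/
theorem integral_residual_mul (h : IsSampledOMD Ψ X Y ρ P η z w w₁ u R) (v : E) :
    ∫ a, (X a v - Y a) * X a (u - v) ∂ρ = -excessRisk X ρ u v := by
  have h1 : ∀ a, (X a v - Y a) * X a (u - v) = (X a u - Y a) * X a (u - v) -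
      X a (v - u) ^ 2 := fun a => by simp only [map_sub]; ring
  have h2 : Integrable (fun a => (X a u - Y a) * X a (u - v)) ρ :=
    MemLp.integrable_mul ((h.memLp_X u).sub h.memLp_Y) (h.memLp_X (u - v))
  simp_rw [h1]
  rw [integral_sub h2 (h.memLp_X (v - u)).integrable_sq, h.normal, zero_sub, excessRisk]

theorem excessRisk_le (h : IsSampledOMD Ψ X Y ρ P η z w w₁ u R) (v : E) :
    excessRisk X ρ u v ≤ R ^ 2 * ‖u - v‖ ^ 2 := by
  calc excessRisk X ρ u v ≤ ∫ _, R ^ 2 * ‖u - v‖ ^ 2 ∂ρ := by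
        refine integral_mono (h.memLp_X (v - u)).integrable_sq (integrable_const _) fun a => ?_
        have : |X a (v - u)| ≤ R * ‖u - v‖ := by
          rw [norm_sub_rev]
          exact ((X a).le_opNorm _).trans (by gcongr; exact h.norm_X_le a)
        dsimp only
        rw [← mul_pow, ← sq_abs]
        gcongr
    _ = _ := by simp

theorem excessRisk_nonneg (X : 𝒵 → StrongDual ℝ E) (ρ : Measure 𝒵) (u v : E) :
    0 ≤ excessRisk X ρ u v := integral_nonneg fun _ => sq_nonneg _

theorem integrable_excessRisk (h : IsSampledOMD Ψ X Y ρ P η z w w₁ u R) {t : ℕ} (ht : 1 ≤ t) :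
    Integrable (fun ω => excessRisk X ρ u (w t ω)) P := by
  have hF : Measurable fun q : E × 𝒵 => X q.2 (q.1 - u) ^ 2 :=
    (h.measurable_apply (measurable_fst.sub measurable_const) measurable_snd).pow_const 2
  exact (setIntegral_sampleHist h.measurable_z h.map_z h.indep ht (h.measurable_hist ht) hF
    ((h.memLp_apply ht ((h.measurable_iterate ht).sub measurable_const)
      ((h.memLp_iterate ht).sub (memLp_const u))).integrable_sq)
    MeasurableSet.univ).1

theorem setIntegral_residual_mul (h : IsSampledOMD Ψ X Y ρ P η z w w₁ u R) {t : ℕ} (ht : 1 ≤ t)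
    {s : Set Ω} (hs : MeasurableSet[sampleHist z t] s) :
    Integrable (fun ω => (X (z t ω) (w t ω) - Y (z t ω)) * X (z t ω) (u - w t ω)) P ∧
      ∫ ω in s, (X (z t ω) (w t ω) - Y (z t ω)) * X (z t ω) (u - w t ω) ∂P =
        -∫ ω in s, excessRisk X ρ u (w t ω) ∂P := by
  have hF : Measurable fun q : E × 𝒵 => (X q.2 q.1 - Y q.2) * X q.2 (u - q.1) :=
    ((h.measurable_apply measurable_fst measurable_snd).sub
      (h.measurable_Y.comp measurable_snd)).mul
      (h.measurable_apply (measurable_const.sub measurable_fst) measurable_snd)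
  have hint : Integrable (fun ω => (X (z t ω) (w t ω) - Y (z t ω)) * X (z t ω) (u - w t ω)) P :=
    MemLp.integrable_mul (h.memLp_residual ht)
      (h.memLp_apply ht (measurable_const.sub (h.measurable_iterate ht)) (h.memLp_error ht))
  refine ⟨hint, ?_⟩
  rw [(setIntegral_sampleHist h.measurable_z h.map_z h.indep ht (h.measurable_hist ht) hF
    hint hs).2, ← integral_neg]
  simp_rw [h.integral_residual_mul]

/-- `V` is a noise level left open: the second moment of the residual at `u` in general, `0` in the
noiseless case. One estimate thus serves both regimes. -/
theorem setIntegral_gradSq_le (h : IsSampledOMD Ψ X Y ρ P η z w w₁ u R) {V : ℝ}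
    (hV : ∀ v, ∫ a, (X a v - Y a) ^ 2 * ‖X a‖ ^ 2 ∂ρ ≤ R ^ 2 * (excessRisk X ρ u v + V))
    {t : ℕ} (ht : 1 ≤ t) {s : Set Ω} (hs : MeasurableSet[sampleHist z t] s) :
    Integrable (fun ω => (X (z t ω) (w t ω) - Y (z t ω)) ^ 2 * ‖X (z t ω)‖ ^ 2) P ∧
      ∫ ω in s, (X (z t ω) (w t ω) - Y (z t ω)) ^ 2 * ‖X (z t ω)‖ ^ 2 ∂P ≤
        R ^ 2 * (∫ ω in s, excessRisk X ρ u (w t ω) ∂P + V * P.real s) := by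
  have hF : Measurable fun q : E × 𝒵 => (X q.2 q.1 - Y q.2) ^ 2 * ‖X q.2‖ ^ 2 :=
    (((h.measurable_apply measurable_fst measurable_snd).sub
      (h.measurable_Y.comp measurable_snd)).pow_const 2).mul
      ((h.measurable_X.comp measurable_snd).norm.pow_const 2)
  have hint : Integrable
      (fun ω => (X (z t ω) (w t ω) - Y (z t ω)) ^ 2 * ‖X (z t ω)‖ ^ 2) P := by
    refine ((h.memLp_residual ht).integrable_sq.mul_const (R ^ 2)).mono'
      (hF.comp ((h.measurable_iterate ht).prodMk (h.measurable_z t ht))).aestronglyMeasurable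
      (Eventually.of_forall fun ω => ?_)
    rw [Real.norm_of_nonneg (by positivity)]
    gcongr
    exact h.norm_X_le _
  obtain ⟨h1, h2⟩ := setIntegral_sampleHist h.measurable_z h.map_z h.indep ht
    (h.measurable_hist ht) hF hint hs
  refine ⟨hint, h2.trans_le ?_⟩
  calc _ ≤ ∫ ω in s, R ^ 2 * (excessRisk X ρ u (w t ω) + V) ∂P :=
        integral_mono h1.restrict ((((h.integrable_excessRisk ht).add
          (integrable_const V)).const_mul _).restrict) fun ω => hV _
    _ = _ := by
      rw [integral_const_mul, integral_add (h.integrable_excessRisk ht).restrict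
        (integrable_const V)]
      simp [mul_comm]

theorem bregman_next_eq (h : IsSampledOMD Ψ X Y ρ P η z w w₁ u R) {t : ℕ} (ht : 1 ≤ t) (ω : Ω) :
    bregman Ψ u (w (t + 1) ω) = bregman Ψ u (w t ω) +
      η t * ((X (z t ω) (w t ω) - Y (z t ω)) * X (z t ω) (u - w t ω)) +
      bregman Ψ (w t ω) (w (t + 1) ω) := by
  rw [bregman_step (h.step t ht ω), mul_assoc]

theorem norm_grad_step_sq (h : IsSampledOMD Ψ X Y ρ P η z w w₁ u R) {t : ℕ} (ht : 1 ≤ t)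
    (ω : Ω) : ‖fderiv ℝ Ψ (w t ω) - fderiv ℝ Ψ (w (t + 1) ω)‖ ^ 2 =
      η t ^ 2 * ((X (z t ω) (w t ω) - Y (z t ω)) ^ 2 * ‖X (z t ω)‖ ^ 2) := by
  rw [h.step t ht, sub_sub_cancel, norm_smul, norm_mul, mul_pow, mul_pow, Real.norm_eq_abs,
    Real.norm_eq_abs, sq_abs, sq_abs, mul_assoc]

theorem norm_grad_step (h : IsSampledOMD Ψ X Y ρ P η z w w₁ u R) {t : ℕ} (ht : 1 ≤ t)
    (ω : Ω) : ‖fderiv ℝ Ψ (w t ω) - fderiv ℝ Ψ (w (t + 1) ω)‖ =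
      η t * (|Y (z t ω) - X (z t ω) (w t ω)| * ‖X (z t ω)‖) := by
  rw [h.step t ht, sub_sub_cancel, norm_smul, norm_mul, Real.norm_eq_abs,
    Real.norm_eq_abs, abs_of_pos (h.step_pos t ht), abs_sub_comm, mul_assoc]

/-- Upper one-step estimate, localized to an event of the past. -/
theorem setIntegral_bregman_next_le (h : IsSampledOMD Ψ X Y ρ P η z w w₁ u R) {σ : ℝ}
    (hσ : 0 < σ) (hconv : IsStronglyConvex Ψ σ) {V : ℝ}
    (hV : ∀ v, ∫ a, (X a v - Y a) ^ 2 * ‖X a‖ ^ 2 ∂ρ ≤ R ^ 2 * (excessRisk X ρ u v + V))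
    {t : ℕ} (ht : 1 ≤ t) {s : Set Ω} (hs : MeasurableSet[sampleHist z t] s) :
    ∫ ω in s, bregman Ψ u (w (t + 1) ω) ∂P ≤ ∫ ω in s, bregman Ψ u (w t ω) ∂P -
      η t * (1 - η t * (R ^ 2 / (2 * σ))) * ∫ ω in s, excessRisk X ρ u (w t ω) ∂P +
      η t ^ 2 * (R ^ 2 * V / (2 * σ)) * P.real s := by
  obtain ⟨hi1, he1⟩ := h.setIntegral_residual_mul ht hs
  obtain ⟨hi2, he2⟩ := h.setIntegral_gradSq_le hV ht hs
  calc ∫ ω in s, bregman Ψ u (w (t + 1) ω) ∂P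
      ≤ ∫ ω in s, (bregman Ψ u (w t ω) +
        η t * ((X (z t ω) (w t ω) - Y (z t ω)) * X (z t ω) (u - w t ω)) +
        η t ^ 2 / (2 * σ) * ((X (z t ω) (w t ω) - Y (z t ω)) ^ 2 * ‖X (z t ω)‖ ^ 2)) ∂P := by
        refine integral_mono (h.integrable_bregman (by omega)).restrict
          (((h.integrable_bregman ht).add (hi1.const_mul _)).add (hi2.const_mul _)).restrict
          fun ω => ?_
        have h1 := hconv.bregman_le_grad hσ (w t ω) (w (t + 1) ω)
        rw [h.norm_grad_step_sq ht] at h1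
        dsimp only
        rw [h.bregman_next_eq ht, div_mul_eq_mul_div]
        linarith
    _ = ∫ ω in s, bregman Ψ u (w t ω) ∂P - η t * ∫ ω in s, excessRisk X ρ u (w t ω) ∂P +
        η t ^ 2 / (2 * σ) *
          ∫ ω in s, (X (z t ω) (w t ω) - Y (z t ω)) ^ 2 * ‖X (z t ω)‖ ^ 2 ∂P := by
        have hi3 : Integrable (fun ω => bregman Ψ u (w t ω) +
            η t * ((X (z t ω) (w t ω) - Y (z t ω)) * X (z t ω) (u - w t ω))) P :=
          (h.integrable_bregman ht).add (hi1.const_mul _)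
        rw [integral_add hi3.restrict (hi2.const_mul _).restrict,
          integral_add (h.integrable_bregman ht).restrict (hi1.const_mul _).restrict,
          integral_const_mul, integral_const_mul, he1]
        ring
    _ ≤ _ := by
        have := mul_le_mul_of_nonneg_left he2 (show 0 ≤ η t ^ 2 / (2 * σ) by positivity)
        refine (add_le_add_right this _).trans_eq ?_
        field_simp
        ring

theorem integral_bregman_next_eq (h : IsSampledOMD Ψ X Y ρ P η z w w₁ u R) {t : ℕ}
    (ht : 1 ≤ t) :
    Integrable (fun ω => bregman Ψ (w t ω) (w (t + 1) ω)) P ∧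
    ∫ ω, bregman Ψ u (w (t + 1) ω) ∂P = ∫ ω, bregman Ψ u (w t ω) ∂P -
      η t * ∫ ω, excessRisk X ρ u (w t ω) ∂P + ∫ ω, bregman Ψ (w t ω) (w (t + 1) ω) ∂P := by
  obtain ⟨hi1, he1⟩ := h.setIntegral_residual_mul ht MeasurableSet.univ
  simp only [Measure.restrict_univ] at he1
  have h1 := fun ω => h.bregman_next_eq ht ω
  -- Integrability is read off the step identity, whose other terms are all integrable.
  have hi2 : Integrable (fun ω => bregman Ψ (w t ω) (w (t + 1) ω)) P := by
    refine (((h.integrable_bregman (Nat.le_add_left 1 t)).sub (h.integrable_bregman ht)).sub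
      (hi1.const_mul (η t))).congr (Eventually.of_forall fun ω => ?_)
    simp only [Pi.sub_apply]
    rw [h1 ω]
    ring
  refine ⟨hi2, ?_⟩
  have hi3 : Integrable (fun ω => bregman Ψ u (w t ω) +
      η t * ((X (z t ω) (w t ω) - Y (z t ω)) * X (z t ω) (u - w t ω))) P :=
    (h.integrable_bregman ht).add (hi1.const_mul _)
  simp_rw [h1]
  rw [integral_add hi3 hi2,
    integral_add (h.integrable_bregman ht) (hi1.const_mul _), integral_const_mul, he1]
  ring

/-- Lower one-step estimate. -/
theorem le_integral_bregman_next (h : IsSampledOMD Ψ X Y ρ P η z w w₁ u R) {σ : ℝ}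
    (hσ : 0 < σ) (hconv : IsStronglyConvex Ψ σ) {t : ℕ} (ht : 1 ≤ t) :
    (1 - R ^ 2 * (2 / σ) * η t) * ∫ ω, bregman Ψ u (w t ω) ∂P +
      ∫ ω, bregman Ψ (w t ω) (w (t + 1) ω) ∂P ≤ ∫ ω, bregman Ψ u (w (t + 1) ω) ∂P := by
  rw [(h.integral_bregman_next_eq ht).2]
  have h1 : ∫ ω, excessRisk X ρ u (w t ω) ∂P ≤
      R ^ 2 * (2 / σ) * ∫ ω, bregman Ψ u (w t ω) ∂P := by
    rw [← integral_const_mul]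
    refine integral_mono (h.integrable_excessRisk ht)
      ((h.integrable_bregman ht).const_mul _) fun ω => (h.excessRisk_le _).trans ?_
    rw [mul_assoc]
    gcongr
    exact hconv.norm_sub_sq_le hσ _ _
  have := mul_le_mul_of_nonneg_left h1 (h.step_pos t ht).le
  linarith

theorem integral_bregman_next_ge (h : IsSampledOMD Ψ X Y ρ P η z w w₁ u R) {σ : ℝ}
    (hσ : 0 < σ) (hconv : IsStronglyConvex Ψ σ) {t : ℕ} (ht : 1 ≤ t) :
    (1 - R ^ 2 * (2 / σ) * η t) * ∫ ω, bregman Ψ u (w t ω) ∂P ≤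
      ∫ ω, bregman Ψ u (w (t + 1) ω) ∂P := by
  have h1 := h.le_integral_bregman_next hσ hconv ht
  have h2 : 0 ≤ ∫ ω, bregman Ψ (w t ω) (w (t + 1) ω) ∂P :=
    integral_nonneg fun ω => hconv.bregman_nonneg hσ _ _
  linarith

/-- The mean length of a gradient step is at least `m η t` when the mean gradient norm is bounded
below by `m`. -/
theorem le_integral_norm_grad_step (h : IsSampledOMD Ψ X Y ρ P η z w w₁ u R) {m : ℝ}
    (hm : ∀ v, m ≤ ∫ a, |Y a - X a v| * ‖X a‖ ∂ρ) {t : ℕ} (ht : 1 ≤ t) :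
    Integrable (fun ω => ‖fderiv ℝ Ψ (w t ω) - fderiv ℝ Ψ (w (t + 1) ω)‖) P ∧
      m * η t ≤ ∫ ω, ‖fderiv ℝ Ψ (w t ω) - fderiv ℝ Ψ (w (t + 1) ω)‖ ∂P := by
  have hF : Measurable fun q : E × 𝒵 => |Y q.2 - X q.2 q.1| * ‖X q.2‖ :=
    ((h.measurable_Y.comp measurable_snd).sub
      (h.measurable_apply measurable_fst measurable_snd)).abs.mul
      (h.measurable_X.comp measurable_snd).norm
  have hint : Integrable (fun ω => |Y (z t ω) - X (z t ω) (w t ω)| * ‖X (z t ω)‖) P := by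
    refine (((h.memLp_residual ht).integrable (by norm_num)).norm.mul_const R).mono'
      (hF.comp ((h.measurable_iterate ht).prodMk (h.measurable_z t ht))).aestronglyMeasurable
      (Eventually.of_forall fun ω => ?_)
    rw [Real.norm_of_nonneg (by positivity), abs_sub_comm]
    exact mul_le_mul_of_nonneg_left (h.norm_X_le _) (abs_nonneg _)
  obtain ⟨h1, h2⟩ := setIntegral_sampleHist h.measurable_z h.map_z h.indep ht
    (h.measurable_hist ht) hF hint MeasurableSet.univ
  simp only [Measure.restrict_univ] at h2
  simp_rw [h.norm_grad_step ht]
  refine ⟨hint.const_mul _, ?_⟩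
  rw [integral_const_mul, h2, mul_comm]
  refine mul_le_mul_of_nonneg_left ?_ (h.step_pos t ht).le
  calc m = ∫ _, m ∂P := by simp
    _ ≤ _ := integral_mono (integrable_const _) h1 fun ω => hm _

end IsSampledOMD

end Run

/-! ### Convergence criteria and rates for the iterates. -/

namespace IsSampledOMD

set_option linter.unusedSectionVars false

variable {E : Type*} [NormedAddCommGroup E] [NormedSpace ℝ E]
  [MeasurableSpace E] [BorelSpace E] [FiniteDimensional ℝ E]
  {𝒵 Ω : Type*} [MeasurableSpace 𝒵] [mΩ : MeasurableSpace Ω]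
  {Ψ : E → ℝ} {X : 𝒵 → StrongDual ℝ E} {Y : 𝒵 → ℝ} {ρ : Measure 𝒵} [IsProbabilityMeasure ρ]
  {P : Measure Ω} [IsProbabilityMeasure P] {η : ℕ → ℝ} {z : ℕ → Ω → 𝒵} {w : ℕ → Ω → E}
  {w₁ u : E} {R σ V lam : ℝ}

theorem integral_bregman_nonneg (h : IsSampledOMD Ψ X Y ρ P η z w w₁ u R) (t : ℕ) :
    0 ≤ ∫ ω, bregman Ψ u (w t ω) ∂P := by
  obtain ⟨σ, hσ, hconv⟩ := h.exists_convex
  exact integral_nonneg fun ω => hconv.bregman_nonneg hσ _ _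

theorem integral_error_nonneg (t : ℕ) : 0 ≤ ∫ ω, ‖u - w t ω‖ ^ 2 ∂P :=
  integral_nonneg fun _ => by positivity

theorem integral_bregman_one (h : IsSampledOMD Ψ X Y ρ P η z w w₁ u R) :
    ∫ ω, bregman Ψ u (w 1 ω) ∂P = bregman Ψ u w₁ := by
  simp [h.init]

theorem integral_error_le (h : IsSampledOMD Ψ X Y ρ P η z w w₁ u R) (hσ : 0 < σ)
    (hconv : IsStronglyConvex Ψ σ) {t : ℕ} (ht : 1 ≤ t) :
    ∫ ω, ‖u - w t ω‖ ^ 2 ∂P ≤ 2 / σ * ∫ ω, bregman Ψ u (w t ω) ∂P := by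
  rw [← integral_const_mul]
  exact integral_mono (h.integrable_error ht) ((h.integrable_bregman ht).const_mul _)
    fun ω => hconv.norm_sub_sq_le hσ _ _

theorem integral_bregman_le_of_smooth (h : IsSampledOMD Ψ X Y ρ P η z w w₁ u R) {L : ℝ}
    (hL : IsStronglySmooth Ψ L) {t : ℕ} (ht : 1 ≤ t) :
    ∫ ω, bregman Ψ u (w t ω) ∂P ≤ L / 2 * ∫ ω, ‖u - w t ω‖ ^ 2 ∂P := by
  rw [← integral_const_mul]
  exact integral_mono (h.integrable_bregman ht) ((h.integrable_error ht).const_mul _)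
    fun ω => hL _ _

theorem exists_integral_bregman_le (h : IsSampledOMD Ψ X Y ρ P η z w w₁ u R) {ε : ℝ}
    (hε : 0 < ε) : ∃ C : ℝ, 0 < C ∧ ∀ t, 1 ≤ t →
      ∫ ω, bregman Ψ u (w t ω) ∂P ≤ ε + C * ∫ ω, ‖u - w t ω‖ ^ 2 ∂P := by
  obtain ⟨σ, hσ, hconv⟩ := h.exists_convex
  obtain ⟨C, hC, hbound⟩ := h.growth.bregman_le hconv hσ u hε
  refine ⟨C, hC, fun t ht => ?_⟩
  calc _ ≤ ∫ ω, (ε + C * ‖u - w t ω‖ ^ 2) ∂P :=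
        integral_mono (h.integrable_bregman ht)
          ((integrable_const ε).add ((h.integrable_error ht).const_mul C)) fun ω => hbound _
    _ = _ := by
        rw [integral_add (integrable_const ε) ((h.integrable_error ht).const_mul C),
          integral_const_mul]
        simp

/-- One direction is strong convexity. The other uses the bound `ε / 2 + C ‖·‖²`, since `Ψ` may fail
to be strongly smooth. -/
theorem tendsto_error_iff (h : IsSampledOMD Ψ X Y ρ P η z w w₁ u R) :
    Tendsto (fun t => ∫ ω, ‖u - w t ω‖ ^ 2 ∂P) atTop (𝓝 0) ↔
      Tendsto (fun t => ∫ ω, bregman Ψ u (w t ω) ∂P) atTop (𝓝 0) := by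
  constructor
  · intro hlim
    rw [Metric.tendsto_atTop]
    intro ε hε
    obtain ⟨C, hC, hbound⟩ := h.exists_integral_bregman_le (half_pos hε)
    obtain ⟨N, hN⟩ := eventually_atTop.1 ((hlim.eventually_lt_const
      (show 0 < ε / (2 * C) by positivity)).and (eventually_ge_atTop 1))
    refine ⟨N, fun t ht => ?_⟩
    rw [Real.dist_eq, sub_zero, abs_of_nonneg (h.integral_bregman_nonneg t)]
    obtain ⟨h1, h2⟩ := hN t ht
    have h3 := hbound t h2
    have h4 := mul_lt_mul_of_pos_left h1 hC
    have h5 : C * (ε / (2 * C)) = ε / 2 := by field_simp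
    linarith
  · intro hlim
    obtain ⟨σ, hσ, hconv⟩ := h.exists_convex
    refine squeeze_zero' (Eventually.of_forall fun t => integral_error_nonneg t) ?_
      (by simpa using hlim.const_mul (2 / σ))
    filter_upwards [eventually_ge_atTop 1] with t ht
    exact h.integral_error_le hσ hconv ht

theorem integral_bregman_next_le (h : IsSampledOMD Ψ X Y ρ P η z w w₁ u R)
    (hσ : 0 < σ) (hconv : IsStronglyConvex Ψ σ)
    (hV : ∀ v, ∫ a, (X a v - Y a) ^ 2 * ‖X a‖ ^ 2 ∂ρ ≤ R ^ 2 * (excessRisk X ρ u v + V))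
    {t : ℕ} (ht : 1 ≤ t) :
    ∫ ω, bregman Ψ u (w (t + 1) ω) ∂P ≤ ∫ ω, bregman Ψ u (w t ω) ∂P -
      η t * (1 - η t * (R ^ 2 / (2 * σ))) * ∫ ω, excessRisk X ρ u (w t ω) ∂P +
      η t ^ 2 * (R ^ 2 * V / (2 * σ)) := by
  simpa using h.setIntegral_bregman_next_le hσ hconv hV ht MeasurableSet.univ

theorem le_integral_excessRisk (h : IsSampledOMD Ψ X Y ρ P η z w w₁ u R)
    (hlam : ∀ v, lam * ‖u - v‖ ^ 2 ≤ excessRisk X ρ u v) {t : ℕ} (ht : 1 ≤ t) :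
    lam * ∫ ω, ‖u - w t ω‖ ^ 2 ∂P ≤ ∫ ω, excessRisk X ρ u (w t ω) ∂P := by
  rw [← integral_const_mul]
  exact integral_mono ((h.integrable_error ht).const_mul _) (h.integrable_excessRisk ht)
    fun ω => hlam _

/-- Convergence in mean from non-summable steps that are eventually small. -/
theorem tendsto_bregman_zero (h : IsSampledOMD Ψ X Y ρ P η z w w₁ u R)
    (hσ : 0 < σ) (hconv : IsStronglyConvex Ψ σ)
    (hV : ∀ v, ∫ a, (X a v - Y a) ^ 2 * ‖X a‖ ^ 2 ∂ρ ≤ R ^ 2 * (excessRisk X ρ u v + V))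
    (hlam0 : 0 < lam) (hlam : ∀ v, lam * ‖u - v‖ ^ 2 ≤ excessRisk X ρ u v)
    {c : ℝ} (hc : 0 < c) (hsmall : ∀ᶠ t in atTop, c ≤ 1 - η t * (R ^ 2 / (2 * σ)))
    (h1 : Tendsto (fun t => η t * (R ^ 2 * V / (2 * σ))) atTop (𝓝 0))
    (h2 : Tendsto (fun t => η t * (η t * (R ^ 2 * V / (2 * σ)))) atTop (𝓝 0))
    (hsum : StepSumDiverges η) :
    Tendsto (fun t => ∫ ω, bregman Ψ u (w t ω) ∂P) atTop (𝓝 0) := by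
  obtain ⟨N, hN⟩ := eventually_atTop.1 (hsmall.and (eventually_ge_atTop 1))
  -- Here `b` is the guaranteed decrease per unit of step and `δ t = η t * (R ^ 2 * V / (2 * σ))`
  -- the noise. If the mean divergence is at least `ε`, then the mean squared error is at least `ε /
  -- (2 * C)`, which bounds `b` below.
  refine tendsto_zero_of_descent (N := N) (η := η)
    (b := fun t => c * (lam * ∫ ω, ‖u - w t ω‖ ^ 2 ∂P))
    (fun t _ => h.integral_bregman_nonneg t) (fun t ht => (h.step_pos t (hN t ht).2).le)
    (fun t _ => mul_nonneg hc.le (mul_nonneg hlam0.le (integral_error_nonneg t)))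
    (fun t ht => ?_) (fun ε hε => ?_) h1 h2 hsum
  · obtain ⟨hct, ht1⟩ := hN t ht
    have h3 := h.integral_bregman_next_le hσ hconv hV ht1
    have h4 : c * (lam * ∫ ω, ‖u - w t ω‖ ^ 2 ∂P) ≤
        (1 - η t * (R ^ 2 / (2 * σ))) * ∫ ω, excessRisk X ρ u (w t ω) ∂P :=
      mul_le_mul hct (h.le_integral_excessRisk hlam ht1)
        (mul_nonneg hlam0.le (integral_error_nonneg t)) (hc.le.trans hct)
    have h5 := mul_le_mul_of_nonneg_left h4 (h.step_pos t ht1).le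
    linarith
  · obtain ⟨C, hC, hbound⟩ := h.exists_integral_bregman_le (half_pos hε)
    refine ⟨c * (lam * (ε / (2 * C))), by positivity, fun t ht hat => ?_⟩
    have h3 := hbound t (hN t ht).2
    gcongr
    rw [div_le_iff₀ (by positivity)]
    linarith

/-- If the mean divergence vanished from some time on, two consecutive iterates would equal `u`
almost surely, contradicting a mean gradient move of at least `m η`. -/
theorem exists_bregman_pos_of_noise (h : IsSampledOMD Ψ X Y ρ P η z w w₁ u R) {m : ℝ}
    (hm0 : 0 < m) (hm : ∀ v, m ≤ ∫ a, |Y a - X a v| * ‖X a‖ ∂ρ) (n : ℕ) :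
    ∃ t, n ≤ t ∧ 0 < ∫ ω, bregman Ψ u (w t ω) ∂P := by
  obtain ⟨σ, hσ, hconv⟩ := h.exists_convex
  by_contra! hcon
  have key : ∀ t, n + 1 ≤ t → ∀ᵐ ω ∂P, w t ω = u := by
    intro t ht
    have h1 := le_antisymm (hcon t (by omega)) (h.integral_bregman_nonneg t)
    rw [integral_eq_zero_iff_of_nonneg (fun ω => hconv.bregman_nonneg hσ _ _)
      (h.integrable_bregman (by omega))] at h1
    filter_upwards [h1] with ω hω
    by_contra hne
    exact (hconv.bregman_pos hσ (Ne.symm hne)).ne' hω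
  have h1 := (h.le_integral_norm_grad_step hm (show 1 ≤ n + 1 by omega)).2
  have h2 : ∫ ω, ‖fderiv ℝ Ψ (w (n + 1) ω) - fderiv ℝ Ψ (w (n + 1 + 1) ω)‖ ∂P = 0 := by
    refine integral_eq_zero_of_ae ?_
    filter_upwards [key (n + 1) le_rfl, key (n + 1 + 1) (by omega)] with ω h3 h4
    simp [h3, h4]
  have h3 := mul_pos hm0 (h.step_pos (n + 1) (by omega))
  linarith

/-- The gradient move is at least `m η t` in mean, yet both of its endpoints approach the gradient
at `u` in mean. Each endpoint costs `m * ε / 4` plus a multiple of its squared error, so eventually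
`m * η t < m * ε`. -/
theorem step_tendsto_zero (h : IsSampledOMD Ψ X Y ρ P η z w w₁ u R) {m : ℝ}
    (hm0 : 0 < m) (hm : ∀ v, m ≤ ∫ a, |Y a - X a v| * ‖X a‖ ∂ρ)
    (hlim : Tendsto (fun t => ∫ ω, ‖u - w t ω‖ ^ 2 ∂P) atTop (𝓝 0)) :
    Tendsto η atTop (𝓝 0) := by
  obtain ⟨σ, hσ, hconv⟩ := h.exists_convex
  rw [Metric.tendsto_atTop]
  intro ε hε
  obtain ⟨C, hC, hbound⟩ := h.growth.norm_grad_sub_le h.differentiable hconv hσ u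
    (show 0 < m * ε / 4 by positivity)
  have hlim2 := (hlim.add ((tendsto_add_atTop_iff_nat 1).2 hlim)).const_mul C
  rw [add_zero, mul_zero] at hlim2
  obtain ⟨N, hN⟩ := eventually_atTop.1 ((hlim2.eventually_lt_const
    (show 0 < m * ε / 2 by positivity)).and (eventually_ge_atTop 1))
  refine ⟨N, fun t ht => ?_⟩
  obtain ⟨h1, ht1⟩ := hN t ht
  rw [Real.dist_eq, sub_zero, abs_of_pos (h.step_pos t ht1)]
  obtain ⟨hi, h2⟩ := h.le_integral_norm_grad_step hm ht1
  have hi1 := (h.integrable_error ht1).const_mul C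
  have hi2 := (h.integrable_error (show 1 ≤ t + 1 by omega)).const_mul C
  have h3 : ∫ ω, ‖fderiv ℝ Ψ (w t ω) - fderiv ℝ Ψ (w (t + 1) ω)‖ ∂P ≤
      m * ε / 2 + (C * ∫ ω, ‖u - w t ω‖ ^ 2 ∂P + C * ∫ ω, ‖u - w (t + 1) ω‖ ^ 2 ∂P) := by
    calc _ ≤ ∫ ω, (m * ε / 2 + (C * ‖u - w t ω‖ ^ 2 + C * ‖u - w (t + 1) ω‖ ^ 2)) ∂P := by
          refine integral_mono hi ((integrable_const _).add (hi1.add hi2)) fun ω => ?_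
          have h4 := hbound (w t ω)
          have h5 := hbound (w (t + 1) ω)
          have h6 := norm_sub_le_norm_sub_add_norm_sub (fderiv ℝ Ψ (w t ω)) (fderiv ℝ Ψ u)
            (fderiv ℝ Ψ (w (t + 1) ω))
          rw [norm_sub_rev (fderiv ℝ Ψ u)] at h6
          dsimp only
          linarith
      _ = _ := by
          have hi3 : Integrable
              (fun ω => C * ‖u - w t ω‖ ^ 2 + C * ‖u - w (t + 1) ω‖ ^ 2) P := hi1.add hi2
          rw [integral_add (integrable_const _) hi3, integral_add hi1 hi2,
            integral_const_mul, integral_const_mul]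
          simp
  have h4 : m * η t < m * ε := by linarith
  exact lt_of_mul_lt_mul_left h4 hm0.le

theorem stepSumDiverges_of_tendsto (h : IsSampledOMD Ψ X Y ρ P η z w w₁ u R)
    (hσ : 0 < σ) (hconv : IsStronglyConvex Ψ σ)
    (hsmall : ∀ᶠ t in atTop, R ^ 2 * (2 / σ) * η t ≤ 1)
    (hpos : ∀ n, ∃ t, n ≤ t ∧ 0 < ∫ ω, bregman Ψ u (w t ω) ∂P)
    (hlim : Tendsto (fun t => ∫ ω, ‖u - w t ω‖ ^ 2 ∂P) atTop (𝓝 0)) : StepSumDiverges η :=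
  stepSumDiverges_of_tendsto_zero h.step_pos (by positivity) hsmall
    (fun _ ht => h.integral_bregman_next_ge hσ hconv ht) hpos (h.tendsto_error_iff.1 hlim)

/-- Mean convergence in the noisy case. -/
theorem tendsto_iff_of_noise (h : IsSampledOMD Ψ X Y ρ P η z w w₁ u R)
    (hV : ∀ v, ∫ a, (X a v - Y a) ^ 2 * ‖X a‖ ^ 2 ∂ρ ≤ R ^ 2 * (excessRisk X ρ u v + V))
    (hlam0 : 0 < lam) (hlam : ∀ v, lam * ‖u - v‖ ^ 2 ≤ excessRisk X ρ u v) {m : ℝ}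
    (hm0 : 0 < m) (hm : ∀ v, m ≤ ∫ a, |Y a - X a v| * ‖X a‖ ∂ρ) :
    Tendsto (fun t => ∫ ω, ‖u - w t ω‖ ^ 2 ∂P) atTop (𝓝 0) ↔
      Tendsto η atTop (𝓝 0) ∧ StepSumDiverges η := by
  obtain ⟨σ, hσ, hconv⟩ := h.exists_convex
  constructor
  · intro hlim
    have hη := h.step_tendsto_zero hm0 hm hlim
    refine ⟨hη, h.stepSumDiverges_of_tendsto hσ hconv ?_ (h.exists_bregman_pos_of_noise hm0 hm)
      hlim⟩
    have := hη.const_mul (R ^ 2 * (2 / σ))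
    rw [mul_zero] at this
    exact this.eventually_le_const one_pos
  · rintro ⟨hη, hsum⟩
    rw [h.tendsto_error_iff]
    have h1 := hη.mul_const (R ^ 2 * V / (2 * σ))
    have h2 := hη.mul h1
    have h3 := hη.mul_const (R ^ 2 / (2 * σ))
    simp only [zero_mul] at h1 h2 h3
    refine h.tendsto_bregman_zero hσ hconv hV hlam0 hlam (c := 1 / 2) (by norm_num) ?_ h1 h2 hsum
    filter_upwards [h3.eventually_le_const (show (0 : ℝ) < 1 / 2 by norm_num)] with t ht
    linarith

/-- With noise, the mean squared error decays no faster than `1 / T`. -/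
theorem exists_inv_le_error (h : IsSampledOMD Ψ X Y ρ P η z w w₁ u R) {m : ℝ}
    (hm0 : 0 < m) (hm : ∀ v, m ≤ ∫ a, |Y a - X a v| * ‖X a‖ ∂ρ) {L : ℝ} (hL0 : 0 < L)
    (hL : IsStronglySmooth Ψ L) (hη : Tendsto η atTop (𝓝 0)) :
    ∃ T₁ : ℕ, ∃ C : ℝ, 0 < C ∧ ∀ T : ℕ, T₁ ≤ T →
      C * (T : ℝ)⁻¹ ≤ ∫ ω, ‖u - w T ω‖ ^ 2 ∂P := by
  obtain ⟨σ, hσ, hconv⟩ := h.exists_convex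
  -- The summand `1` makes `k` positive even if `R = 0`; it costs only a nonnegative multiple of the
  -- mean divergence.
  set k := R ^ 2 * (2 / σ) + 1 with hk
  have hk0 : 0 < k := by positivity
  -- Chosen so that `q (2 L r)² = σ r² / 2`: the gradient gap is at most `2 L r`, the divergence at
  -- least `σ r² / 2`.
  set q := σ / (8 * L ^ 2) with hq
  have hq0 : 0 < q := by positivity
  have hlim := hη.const_mul k
  rw [mul_zero] at hlim
  obtain ⟨N₀, hN₀⟩ := eventually_atTop.1 ((hlim.eventually_le_const
    (show (0 : ℝ) < 1 / 2 by norm_num)).and (eventually_ge_atTop 1))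
  obtain ⟨N, hN, hpos⟩ := h.exists_bregman_pos_of_noise hm0 hm N₀
  obtain ⟨C, hC, hbound⟩ := exists_div_le_of_recursion
    (a := fun t => ∫ ω, bregman Ψ u (w t ω) ∂P) (η := η) (k := k) (q := q * m ^ 2)
    hk0 (by positivity) (hN₀ N hN).2
    (fun t ht => (hN₀ t (hN.trans ht)).1) (fun t ht => by
      have ht1 := (hN₀ t (hN.trans ht)).2
      have h1 := h.le_integral_bregman_next hσ hconv ht1
      obtain ⟨hi, h2⟩ := h.le_integral_norm_grad_step hm ht1
      have hη0 := h.step_pos t ht1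
      set f := fun ω => ‖fderiv ℝ Ψ (w t ω) - fderiv ℝ Ψ (w (t + 1) ω)‖ with hf
      -- Jensen's inequality in tangent form, `f² ≥ 2 a f - a²` with `a = m * η t`, which needs only
      -- integrability of `f`.
      have h3 : q * (2 * (m * η t) * ∫ ω, f ω ∂P - (m * η t) ^ 2) ≤
          ∫ ω, bregman Ψ (w t ω) (w (t + 1) ω) ∂P := by
        have hi2 := ((hi.const_mul (2 * (m * η t))).sub
          (integrable_const ((m * η t) ^ 2))).const_mul q
        calc _ = ∫ ω, q * (2 * (m * η t) * f ω - (m * η t) ^ 2) ∂P := by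
              rw [integral_const_mul, integral_sub (hi.const_mul _) (integrable_const _),
                integral_const_mul]
              simp
          _ ≤ _ := by
              refine integral_mono hi2 (h.integral_bregman_next_eq ht1).1 fun ω => ?_
              have h4 : f ω ≤ 2 * L * ‖w t ω - w (t + 1) ω‖ :=
                hL.norm_grad_sub_le hL0 hconv hσ (w (t + 1) ω) (w t ω)
              have h5 : f ω ^ 2 ≤ (2 * L * ‖w t ω - w (t + 1) ω‖) ^ 2 :=
                pow_le_pow_left₀ (norm_nonneg _) h4 2
              have h6 := hconv (w t ω) (w (t + 1) ω)
              have h7 : q * (2 * L * ‖w t ω - w (t + 1) ω‖) ^ 2 =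
                  σ / 2 * ‖w t ω - w (t + 1) ω‖ ^ 2 := by rw [hq]; field_simp; norm_num
              dsimp only
              calc q * (2 * (m * η t) * f ω - (m * η t) ^ 2) ≤ q * f ω ^ 2 := by
                    gcongr
                    nlinarith [sq_nonneg (f ω - m * η t)]
                _ ≤ q * (2 * L * ‖w t ω - w (t + 1) ω‖) ^ 2 := by gcongr
                _ ≤ _ := h7.trans_le h6
      have h4 : q * m ^ 2 * η t ^ 2 ≤ q * (2 * (m * η t) * ∫ ω, f ω ∂P - (m * η t) ^ 2) := by
        rw [mul_assoc, ← mul_pow]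
        gcongr
        nlinarith [mul_le_mul_of_nonneg_left h2 (mul_pos hm0 hη0).le]
      have h5 := mul_nonneg hη0.le (h.integral_bregman_nonneg t)
      rw [hk]
      linarith) hpos
  refine ⟨N, 2 / L * C, by positivity, fun T hT => ?_⟩
  have h1 := hbound T hT
  have h2 := h.integral_bregman_le_of_smooth hL (hN₀ T (hN.trans hT)).2
  rw [mul_assoc, div_mul_eq_mul_div, div_le_iff₀ hL0]
  linarith

/-- The rate `O(1 / T)` for the step sizes `4 / ((t + 1) s)`. -/
theorem error_isBigO_inv (h : IsSampledOMD Ψ X Y ρ P η z w w₁ u R) (hV0 : 0 ≤ V)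
    (hV : ∀ v, ∫ a, (X a v - Y a) ^ 2 * ‖X a‖ ^ 2 ∂ρ ≤ R ^ 2 * (excessRisk X ρ u v + V))
    {s : ℝ} (hs0 : 0 < s) (hs : ∀ v, s * bregman Ψ u v ≤ excessRisk X ρ u v)
    (hη : ∀ t : ℕ, 1 ≤ t → η t = 4 / (((t : ℝ) + 1) * s)) :
    (fun T : ℕ => ∫ ω, ‖u - w T ω‖ ^ 2 ∂P) =O[atTop] fun T : ℕ => (T : ℝ)⁻¹ := by
  obtain ⟨σ, hσ, hconv⟩ := h.exists_convex
  have hlim : Tendsto (fun t : ℕ => 4 / (((t : ℝ) + 1) * s) * (R ^ 2 / (2 * σ))) atTop (𝓝 0) := by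
    have h1 := (tendsto_one_div_add_atTop_nhds_zero_nat (𝕜 := ℝ)).const_mul
      (4 / s * (R ^ 2 / (2 * σ)))
    rw [mul_zero] at h1
    refine h1.congr fun t => ?_
    field_simp
  obtain ⟨N, hN⟩ := eventually_atTop.1 ((hlim.eventually_le_const
    (show (0 : ℝ) < 1 / 2 by norm_num)).and (eventually_ge_atTop 1))
  have hrec : (fun T : ℕ => ∫ ω, bregman Ψ u (w T ω) ∂P) =O[atTop] fun T : ℕ => (T : ℝ)⁻¹ := by
    -- Half of the excess risk survives the step, so the contraction is `η s / 2 = 2 / (t + 1)`; the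
    -- noise term `η² R² V / (2σ)` is `K / (t + 1)²`.
    refine isBigO_inv_of_recursion (K := 16 / s ^ 2 * (R ^ 2 * V / (2 * σ))) (N := N)
      (by positivity) (fun t _ => h.integral_bregman_nonneg t) fun t ht => ?_
    obtain ⟨h1, ht1⟩ := hN t ht
    have h2 := h.integral_bregman_next_le hσ hconv hV ht1
    have hη0 := h.step_pos t ht1
    have h3 : s * ∫ ω, bregman Ψ u (w t ω) ∂P ≤ ∫ ω, excessRisk X ρ u (w t ω) ∂P := by
      rw [← integral_const_mul]
      exact integral_mono ((h.integrable_bregman ht1).const_mul _) (h.integrable_excessRisk ht1)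
        fun ω => hs _
    rw [← hη t ht1] at h1
    have h4 : 1 / 2 * (s * ∫ ω, bregman Ψ u (w t ω) ∂P) ≤
        (1 - η t * (R ^ 2 / (2 * σ))) * ∫ ω, excessRisk X ρ u (w t ω) ∂P :=
      mul_le_mul (by linarith) h3 (mul_nonneg hs0.le (h.integral_bregman_nonneg t))
        (by linarith)
    have h5 := mul_le_mul_of_nonneg_left h4 hη0.le
    have h6 : η t * (1 / 2 * (s * ∫ ω, bregman Ψ u (w t ω) ∂P)) =
        2 / ((t : ℝ) + 1) * ∫ ω, bregman Ψ u (w t ω) ∂P := by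
      rw [hη t ht1]; field_simp; norm_num
    have h7 : η t ^ 2 * (R ^ 2 * V / (2 * σ)) =
        16 / s ^ 2 * (R ^ 2 * V / (2 * σ)) / ((t : ℝ) + 1) ^ 2 := by
      rw [hη t ht1]; field_simp; ring
    linarith
  refine IsBigO.trans (IsBigO.of_bound (2 / σ) ?_) hrec
  filter_upwards [eventually_ge_atTop 1] with t ht
  rw [Real.norm_of_nonneg (integral_error_nonneg t),
    Real.norm_of_nonneg (h.integral_bregman_nonneg t)]
  exact h.integral_error_le hσ hconv ht

/-- Mean convergence in the noiseless case. -/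
theorem tendsto_iff_of_noiseless (h : IsSampledOMD Ψ X Y ρ P η z w w₁ u R)
    (hσ : 0 < σ) (hconv : IsStronglyConvex Ψ σ) (hR : 0 < R)
    (hV : ∀ v, ∫ a, (X a v - Y a) ^ 2 * ‖X a‖ ^ 2 ∂ρ ≤ R ^ 2 * (excessRisk X ρ u v + 0))
    (hlam0 : 0 < lam) (hlam : ∀ v, lam * ‖u - v‖ ^ 2 ≤ excessRisk X ρ u v) (hne : u ≠ w₁)
    {κ : ℝ} (hκ : 0 < κ) (hη : ∀ t, 1 ≤ t → η t ≤ σ / ((2 + κ) * R ^ 2)) :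
    Tendsto (fun t => ∫ ω, ‖u - w t ω‖ ^ 2 ∂P) atTop (𝓝 0) ↔ StepSumDiverges η := by
  have hη' : ∀ t, 1 ≤ t → (2 + κ) * R ^ 2 * η t ≤ σ := fun t ht => by
    have := hη t ht
    rw [le_div_iff₀ (by positivity)] at this
    linarith
  have hRη : ∀ t, 1 ≤ t → 0 ≤ R ^ 2 * η t := fun t ht =>
    mul_nonneg (sq_nonneg R) (h.step_pos t ht).le
  constructor
  · intro hlim
    have hsmall : ∀ t, 1 ≤ t → R ^ 2 * (2 / σ) * η t < 1 := fun t ht => by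
      have h1 := hη' t ht
      have h0 : 0 < R ^ 2 * η t := mul_pos (by positivity) (h.step_pos t ht)
      have : R ^ 2 * (2 / σ) * η t = 2 * (R ^ 2 * η t) / σ := by ring
      rw [this, div_lt_one hσ]
      nlinarith
    -- Without noise nothing pushes an iterate off `u`; positivity is inherited from `u ≠ w₁`
    -- because `k η < 1` strictly.
    have hpos : ∀ t, 1 ≤ t → 0 < ∫ ω, bregman Ψ u (w t ω) ∂P := by
      intro t ht
      induction t, ht using Nat.le_induction with
      | base => rw [h.integral_bregman_one]; exact hconv.bregman_pos hσ hne
      | succ t ht ih =>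
        exact (mul_pos (sub_pos.2 (hsmall t ht)) ih).trans_le
          (h.integral_bregman_next_ge hσ hconv ht)
    refine h.stepSumDiverges_of_tendsto hσ hconv ?_
      (fun n => ⟨n + 1, by omega, hpos _ (by omega)⟩) hlim
    filter_upwards [eventually_ge_atTop 1] with t ht using (hsmall t ht).le
  · intro hsum
    rw [h.tendsto_error_iff]
    -- With `V = 0` the noise terms vanish identically, so the steps need not tend to zero.
    refine h.tendsto_bregman_zero hσ hconv hV hlam0 hlam (c := 1 / 2) (by norm_num) ?_
      (by simp) (by simp) hsum
    filter_upwards [eventually_ge_atTop 1] with t ht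
    have h1 := hη' t ht
    have h2 : η t * (R ^ 2 / (2 * σ)) ≤ 1 / 2 := by
      rw [← mul_div_assoc, div_le_div_iff₀ (by positivity) (by norm_num)]
      nlinarith [hRη t ht, mul_nonneg hκ.le (hRη t ht)]
    linarith

/-- Linear convergence with a constant step in the noiseless case. -/
theorem linear_rate_of_noiseless (h : IsSampledOMD Ψ X Y ρ P η z w w₁ u R)
    (hσ : 0 < σ) (hconv : IsStronglyConvex Ψ σ) (hR : 0 < R)
    (hV : ∀ v, ∫ a, (X a v - Y a) ^ 2 * ‖X a‖ ^ 2 ∂ρ ≤ R ^ 2 * (excessRisk X ρ u v + 0))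
    (hlam0 : 0 < lam) (hlam : ∀ v, lam * ‖u - v‖ ^ 2 ≤ excessRisk X ρ u v) (hne : u ≠ w₁)
    {L : ℝ} (hL0 : 0 < L) (hL : IsStronglySmooth Ψ L) (hη : ∀ t, 1 ≤ t → η t = η 1)
    (hη1 : η 1 < σ / (2 * R ^ 2)) :
    ∃ c₁ ∈ Set.Ioo (0 : ℝ) 1, ∃ c₂ ∈ Set.Ioo (0 : ℝ) 1, ∀ T : ℕ, 1 ≤ T →
      c₁ ^ T * ‖u - w₁‖ ^ 2 ≤ ∫ ω, ‖u - w T ω‖ ^ 2 ∂P ∧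
      ∫ ω, ‖u - w T ω‖ ^ 2 ∂P ≤ L / σ * c₂ ^ (T - 1) * ‖u - w₁‖ ^ 2 := by
  have hη0 := h.step_pos 1 le_rfl
  rw [lt_div_iff₀ (by positivity)] at hη1
  set k := R ^ 2 * (2 / σ) * η 1 with hk
  have hk0 : 0 < k := by positivity
  have hk1 : k < 1 := by
    have : k = η 1 * (2 * R ^ 2) / σ := by rw [hk]; ring
    rw [this, div_lt_one hσ]
    exact hη1
  set e := η 1 * (1 / 2) * (lam * (2 / L)) with he
  have he0 : 0 < e := by positivity
  have : Nontrivial E := ⟨u, w₁, hne⟩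
  have hσL : σ / L ≤ 1 := (div_le_one hL0).2 (hconv.le_of_nontrivial hL)
  have hlow : ∀ T, 1 ≤ T → (1 - k) ^ (T - 1) * bregman Ψ u w₁ ≤
      ∫ ω, bregman Ψ u (w T ω) ∂P := by
    intro T hT
    induction T, hT using Nat.le_induction with
    | base => simp [h.init]
    | succ T hT ih =>
      have h1 := h.integral_bregman_next_ge hσ hconv hT
      rw [hη T hT, ← hk] at h1
      refine le_trans ?_ h1
      obtain ⟨r, rfl⟩ : ∃ r, T = r + 1 := ⟨T - 1, by omega⟩
      simp only [Nat.add_sub_cancel] at ih ⊢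
      rw [pow_succ', mul_assoc]
      exact mul_le_mul_of_nonneg_left ih (by linarith)
  have hup : ∀ T, 1 ≤ T → ∫ ω, bregman Ψ u (w T ω) ∂P ≤
      max (1 - e) (1 / 2) ^ (T - 1) * bregman Ψ u w₁ := by
    intro T hT
    induction T, hT using Nat.le_induction with
    | base => simp [h.init]
    | succ T hT ih =>
      have h1 := h.integral_bregman_next_le hσ hconv hV hT
      have h2 := h.le_integral_excessRisk hlam hT
      have h3 := h.integral_bregman_le_of_smooth hL hT
      rw [hη T hT] at h1
      have h4 : η 1 * (R ^ 2 / (2 * σ)) ≤ 1 / 2 := by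
        rw [← mul_div_assoc, div_le_div_iff₀ (by positivity) (by norm_num)]
        nlinarith [mul_pos hη0 (pow_pos hR 2)]
      have h5 : lam * (2 / L) * ∫ ω, bregman Ψ u (w T ω) ∂P ≤
          ∫ ω, excessRisk X ρ u (w T ω) ∂P := by
        refine le_trans ?_ h2
        rw [mul_assoc]
        gcongr
        rw [div_mul_eq_mul_div, div_le_iff₀ hL0]
        linarith
      have h6 : 1 / 2 * (lam * (2 / L) * ∫ ω, bregman Ψ u (w T ω) ∂P) ≤
          (1 - η 1 * (R ^ 2 / (2 * σ))) * ∫ ω, excessRisk X ρ u (w T ω) ∂P :=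
        mul_le_mul (by linarith) h5 (mul_nonneg (by positivity) (h.integral_bregman_nonneg T))
          (by linarith)
      have h7 := mul_le_mul_of_nonneg_left h6 hη0.le
      have h8 : ∫ ω, bregman Ψ u (w (T + 1) ω) ∂P ≤
          (1 - e) * ∫ ω, bregman Ψ u (w T ω) ∂P := by
        rw [mul_zero, zero_div, mul_zero, add_zero] at h1
        rw [he]
        linarith
      refine h8.trans ?_
      obtain ⟨r, rfl⟩ : ∃ r, T = r + 1 := ⟨T - 1, by omega⟩
      simp only [Nat.add_sub_cancel] at ih ⊢
      rw [pow_succ', mul_assoc]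
      exact mul_le_mul (le_max_left _ _) ih (h.integral_bregman_nonneg _)
        (le_trans (by norm_num) (le_max_right _ _))
  have hD1 : σ / 2 * ‖u - w₁‖ ^ 2 ≤ bregman Ψ u w₁ := hconv u w₁
  have hD2 : bregman Ψ u w₁ ≤ L / 2 * ‖u - w₁‖ ^ 2 := hL u w₁
  have hmin0 : 0 < min (1 - k) (σ / L) := lt_min (by linarith) (by positivity)
  have hmax0 : 0 < max (1 - e) (1 / 2) := lt_of_lt_of_le (by norm_num) (le_max_right _ _)
  -- Passing from divergence to norm costs a factor `σ / L ≤ 1`, absorbed by the extra power in `c₁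
  -- ^ T`. The maximum with `1 / 2` keeps `c₂` positive without a separate bound on `e`.
  refine ⟨min (1 - k) (σ / L), ⟨hmin0, (min_le_left _ _).trans_lt (by linarith)⟩,
    max (1 - e) (1 / 2), ⟨hmax0, max_lt (by linarith) (by norm_num)⟩, fun T hT => ⟨?_, ?_⟩⟩
  · have h1 := (hlow T hT).trans (h.integral_bregman_le_of_smooth hL hT)
    have h2 : min (1 - k) (σ / L) ^ T ≤ σ / L * (1 - k) ^ (T - 1) := by
      obtain ⟨r, rfl⟩ : ∃ r, T = r + 1 := ⟨T - 1, by omega⟩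
      rw [pow_succ', Nat.add_sub_cancel]
      exact mul_le_mul (min_le_right _ _) (pow_le_pow_left₀ hmin0.le (min_le_left _ _) r)
        (by positivity) (by positivity)
    have h3 : 0 ≤ (1 - k) ^ (T - 1) := pow_nonneg (by linarith) _
    calc min (1 - k) (σ / L) ^ T * ‖u - w₁‖ ^ 2
        ≤ σ / L * (1 - k) ^ (T - 1) * ‖u - w₁‖ ^ 2 := by gcongr
      _ = 2 / L * ((1 - k) ^ (T - 1) * (σ / 2 * ‖u - w₁‖ ^ 2)) := by field_simp
      _ ≤ 2 / L * ((1 - k) ^ (T - 1) * bregman Ψ u w₁) := by gcongr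
      _ ≤ 2 / L * (L / 2 * ∫ ω, ‖u - w T ω‖ ^ 2 ∂P) := by gcongr
      _ = _ := by field_simp
  · calc ∫ ω, ‖u - w T ω‖ ^ 2 ∂P ≤ 2 / σ * ∫ ω, bregman Ψ u (w T ω) ∂P :=
          h.integral_error_le hσ hconv hT
      _ ≤ 2 / σ * (max (1 - e) (1 / 2) ^ (T - 1) * (L / 2 * ‖u - w₁‖ ^ 2)) := by
          gcongr
          exact (hup T hT).trans (by gcongr)
      _ = _ := by field_simp

/-- Almost sure convergence for square-summable, non-summable steps. -/
theorem ae_tendsto_error (h : IsSampledOMD Ψ X Y ρ P η z w w₁ u R) (hV0 : 0 ≤ V)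
    (hV : ∀ v, ∫ a, (X a v - Y a) ^ 2 * ‖X a‖ ^ 2 ∂ρ ≤ R ^ 2 * (excessRisk X ρ u v + V))
    (hlam0 : 0 < lam) (hlam : ∀ v, lam * ‖u - v‖ ^ 2 ≤ excessRisk X ρ u v)
    (hsum : StepSumDiverges η) (hsq : Summable fun t => η t ^ 2) :
    ∀ᵐ ω ∂P, Tendsto (fun t => ‖u - w t ω‖ ^ 2) atTop (𝓝 0) := by
  obtain ⟨σ, hσ, hconv⟩ := h.exists_convex
  have hη : Tendsto η atTop (𝓝 0) := by
    have h1 := (Real.continuous_sqrt.tendsto 0).comp hsq.tendsto_atTop_zero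
    rw [Real.sqrt_zero] at h1
    refine h1.congr' ?_
    filter_upwards [eventually_ge_atTop 1] with t ht
    exact Real.sqrt_sq (h.step_pos t ht).le
  set κ := R ^ 2 * V / (2 * σ) with hκ
  have hκ0 : 0 ≤ κ := by positivity
  have h1 := hη.mul_const κ
  have h2 := hη.mul h1
  have h3 := hη.mul_const (R ^ 2 / (2 * σ))
  simp only [zero_mul] at h1 h2 h3
  have hsmall : ∀ᶠ t in atTop, (1 : ℝ) / 2 ≤ 1 - η t * (R ^ 2 / (2 * σ)) := by
    filter_upwards [h3.eventually_le_const (show (0 : ℝ) < 1 / 2 by norm_num)] with t ht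
    linarith
  have hmean := h.tendsto_bregman_zero hσ hconv hV hlam0 hlam (c := 1 / 2) (by norm_num)
    hsmall h1 h2 hsum
  obtain ⟨N, hN⟩ := eventually_atTop.1 (hsmall.and (eventually_ge_atTop 1))
  have hN1 : ∀ n, 1 ≤ n + N := fun n => by have := (hN N le_rfl).2; omega
  set S : ℕ → ℝ := fun n => ∑ i ∈ Finset.range n, η (i + N) ^ 2 with hS
  have hsqN : Summable fun i => η (i + N) ^ 2 := (summable_nat_add_iff N).2 hsq
  have hStend : Tendsto S atTop (𝓝 (∑' i, η (i + N) ^ 2)) := hsqN.hasSum.tendsto_sum_nat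
  have hSle : ∀ n, S n ≤ ∑' i, η (i + N) ^ 2 := fun n =>
    hsqN.sum_le_tsum _ fun _ _ => sq_nonneg _
  have hS0 : ∀ n, 0 ≤ S n := fun n => Finset.sum_nonneg fun _ _ => sq_nonneg _
  -- Time is shifted by `N`, from where the steps are small enough for descent up to noise on every
  -- past event.
  let 𝒢 : Filtration ℕ mΩ :=
    { seq := fun n => sampleHist z (n + N)
      mono' := fun i j hij => sampleHist_mono z (by omega)
      le' := fun n => sampleHist_le h.measurable_z _ }
  set D : ℕ → Ω → ℝ := fun n ω => bregman Ψ u (w (n + N) ω) with hD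
  have hDi : ∀ n, Integrable (D n) P := fun n => h.integrable_bregman (hN1 n)
  have hD0 : ∀ n ω, 0 ≤ D n ω := fun n ω => hconv.bregman_nonneg hσ _ _
  have hdesc : ∀ n s, MeasurableSet[sampleHist z (n + N)] s →
      ∫ ω in s, D (n + 1) ω ∂P ≤ ∫ ω in s, D n ω ∂P + η (n + N) ^ 2 * κ * P.real s := by
    intro n s hs
    have h4 := h.setIntegral_bregman_next_le hσ hconv hV (hN1 n) hs
    have h5 : 0 ≤ ∫ ω in s, excessRisk X ρ u (w (n + N) ω) ∂P :=
      integral_nonneg fun ω => excessRisk_nonneg X ρ u _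
    have h6 := mul_nonneg (mul_nonneg (h.step_pos _ (hN1 n)).le
      (le_trans (by norm_num) (hN (n + N) (by omega)).1)) h5
    simp only [hD]
    rw [show n + 1 + N = n + N + 1 by ring]
    linarith
  -- Negated, `D n - κ S n` is a supermartingale: the partial sums compensate the noise. They are
  -- bounded, which makes the process bounded in `L¹` and hence almost surely convergent.
  have hsub : Submartingale (fun n ω => κ * S n - D n ω) 𝒢 P := by
    refine submartingale_of_setIntegral_le_succ (fun n => ?_)
      (fun n => (integrable_const _).sub (hDi n)) fun n s hs => ?_
    · have : Measurable[sampleHist z (n + N)] fun ω => κ * S n - D n ω :=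
        measurable_const.sub (h.measurable_bregman.comp (h.measurable_hist (hN1 n)))
      exact this.stronglyMeasurable
    · have h4 := hdesc n s hs
      rw [integral_sub (integrable_const _) (hDi n).restrict,
        integral_sub (integrable_const _) (hDi (n + 1)).restrict]
      have h5 : S (n + 1) = S n + η (n + N) ^ 2 := Finset.sum_range_succ _ _
      simp only [integral_const, smul_eq_mul, h5]
      have h6 : (P.restrict s).real Set.univ = P.real s := by simp
      rw [h6]
      linarith
  have hDbound : ∀ n, ∫ ω, D n ω ∂P ≤ ∫ ω, D 0 ω ∂P + κ * S n := by
    intro n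
    induction n with
    | zero => simp [hS]
    | succ n ih =>
      have h4 := hdesc n Set.univ MeasurableSet.univ
      simp only [Measure.restrict_univ, probReal_univ, mul_one] at h4
      have h5 : S (n + 1) = S n + η (n + N) ^ 2 := Finset.sum_range_succ _ _
      rw [h5]
      linarith
  set B := ∫ ω, D 0 ω ∂P + 2 * (κ * ∑' i, η (i + N) ^ 2) with hB
  have hL1 : ∀ n, eLpNorm (fun ω => κ * S n - D n ω) 1 P ≤ (B.toNNReal : ENNReal) := by
    intro n
    have hi : Integrable (fun ω => κ * S n - D n ω) P := (integrable_const _).sub (hDi n)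
    rw [eLpNorm_one_eq_lintegral_enorm, ← ofReal_integral_norm_eq_lintegral_enorm hi]
    refine ENNReal.ofReal_le_ofReal ?_
    calc ∫ ω, ‖κ * S n - D n ω‖ ∂P ≤ ∫ ω, (κ * S n + D n ω) ∂P := by
          refine integral_mono hi.norm ((integrable_const _).add (hDi n)) fun ω => ?_
          refine (norm_sub_le _ _).trans_eq ?_
          rw [Real.norm_of_nonneg (mul_nonneg hκ0 (hS0 n)), Real.norm_of_nonneg (hD0 n ω)]
      _ = κ * S n + ∫ ω, D n ω ∂P := by
          rw [integral_add (integrable_const _) (hDi n)]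
          simp
      _ ≤ B := by
          have := mul_le_mul_of_nonneg_left (hSle n) hκ0
          linarith [hDbound n]
  have hmeanN : Tendsto (fun n => ∫ ω, D n ω ∂P) atTop (𝓝 0) :=
    (tendsto_add_atTop_iff_nat N).2 hmean
  -- Fatou applied to the mean convergence already known; the almost sure limit of `D n` must agree
  -- with this lower limit.
  have hliminf : ∀ᵐ ω ∂P, liminf (fun n => ENNReal.ofReal (D n ω)) atTop = 0 := by
    have hDm : ∀ n, Measurable (D n) := fun n =>
      h.measurable_bregman.comp (h.measurable_iterate (hN1 n))
    have hfat := lintegral_liminf_le (μ := P) (u := atTop)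
      (f := fun n ω => ENNReal.ofReal (D n ω)) fun n => (hDm n).ennreal_ofReal
    have h4 : Tendsto (fun n => ∫⁻ ω, ENNReal.ofReal (D n ω) ∂P) atTop (𝓝 0) := by
      have h5 : ∀ n, ∫⁻ ω, ENNReal.ofReal (D n ω) ∂P = ENNReal.ofReal (∫ ω, D n ω ∂P) :=
        fun n => (ofReal_integral_eq_lintegral_ofReal (hDi n)
          (Eventually.of_forall (hD0 n))).symm
      simp_rw [h5]
      simpa using ENNReal.tendsto_ofReal hmeanN
    rw [h4.liminf_eq, nonpos_iff_eq_zero, lintegral_eq_zero_iff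
      (Measurable.liminf fun n => (hDm n).ennreal_ofReal)] at hfat
    exact hfat
  filter_upwards [hsub.ae_tendsto_limitProcess hL1, hliminf] with ω hω1 hω2
  have h4 := (hStend.const_mul κ).sub hω1
  simp only [sub_sub_cancel] at h4
  set ℓ := κ * ∑' i, η (i + N) ^ 2 -
    Filtration.limitProcess (fun n ω => κ * S n - D n ω) 𝒢 P ω
  have h5 := (ENNReal.tendsto_ofReal h4).liminf_eq
  rw [hω2] at h5
  have h6 : ℓ = 0 := le_antisymm (ENNReal.ofReal_eq_zero.1 h5.symm)
    (ge_of_tendsto' h4 fun n => hD0 n ω)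
  rw [h6] at h4
  have h7 : Tendsto (fun t => bregman Ψ u (w t ω)) atTop (𝓝 0) :=
    (tendsto_add_atTop_iff_nat N).1 h4
  refine squeeze_zero (fun t => by positivity) (fun t => hconv.norm_sub_sq_le hσ _ _)
    (by simpa using h7.const_mul (2 / σ))

end IsSampledOMD

/-! ### Second moment of the stochastic gradient, with and without noise. -/

namespace IsSampledOMD

set_option linter.unusedSectionVars false

variable {E : Type*} [NormedAddCommGroup E] [NormedSpace ℝ E]
  [MeasurableSpace E] [BorelSpace E] [FiniteDimensional ℝ E]
  {𝒵 Ω : Type*} [MeasurableSpace 𝒵] [mΩ : MeasurableSpace Ω]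
  {Ψ : E → ℝ} {X : 𝒵 → StrongDual ℝ E} {Y : 𝒵 → ℝ} {ρ : Measure 𝒵} [IsProbabilityMeasure ρ]
  {P : Measure Ω} [IsProbabilityMeasure P] {η : ℕ → ℝ} {z : ℕ → Ω → 𝒵} {w : ℕ → Ω → E}
  {w₁ u : E} {R lam : ℝ}

/-- By the normal equations the squared residual at `v` splits orthogonally into excess risk and
residual variance at `u`. -/
theorem integral_gradSq_le (h : IsSampledOMD Ψ X Y ρ P η z w w₁ u R) (v : E) :
    ∫ a, (X a v - Y a) ^ 2 * ‖X a‖ ^ 2 ∂ρ ≤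
      R ^ 2 * (excessRisk X ρ u v + ∫ a, (X a u - Y a) ^ 2 ∂ρ) := by
  have h1 : MemLp (fun a => X a v - Y a) 2 ρ := (h.memLp_X v).sub h.memLp_Y
  have h2 : MemLp (fun a => X a u - Y a) 2 ρ := (h.memLp_X u).sub h.memLp_Y
  have h3 : Integrable (fun a => (X a u - Y a) * X a (v - u)) ρ :=
    MemLp.integrable_mul h2 (h.memLp_X (v - u))
  have h4 : ∫ a, (X a v - Y a) ^ 2 ∂ρ =
      excessRisk X ρ u v + ∫ a, (X a u - Y a) ^ 2 ∂ρ := by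
    have h5 : ∀ a, (X a v - Y a) ^ 2 = (X a (v - u) ^ 2 + (X a u - Y a) ^ 2) +
        2 * ((X a u - Y a) * X a (v - u)) := fun a => by simp only [map_sub]; ring
    have h6 : Integrable (fun a => X a (v - u) ^ 2 + (X a u - Y a) ^ 2) ρ :=
      (h.memLp_X (v - u)).integrable_sq.add h2.integrable_sq
    simp_rw [h5]
    rw [integral_add h6 (h3.const_mul 2),
      integral_add (h.memLp_X (v - u)).integrable_sq h2.integrable_sq, integral_const_mul,
      h.normal, mul_zero, add_zero, excessRisk]
  rw [← h4, ← integral_const_mul]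
  refine integral_mono_of_nonneg (Eventually.of_forall fun a => by positivity)
    (h1.integrable_sq.const_mul _) (Eventually.of_forall fun a => ?_)
  dsimp only
  rw [mul_comm]
  gcongr
  exact h.norm_X_le a

/-- Almost surely the residual at `u` vanishes or the input does. In the second case the left
integrand is zero, so `V = 0` is admissible even if `Y` carries noise where the input is zero. -/
theorem integral_gradSq_le_of_noiseless (h : IsSampledOMD Ψ X Y ρ P η z w w₁ u R)
    (hzero : ∫ a, |Y a - X a u| * ‖X a‖ ∂ρ = 0) (v : E) :
    ∫ a, (X a v - Y a) ^ 2 * ‖X a‖ ^ 2 ∂ρ ≤ R ^ 2 * (excessRisk X ρ u v + 0) := by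
  have hi : Integrable (fun a => |Y a - X a u| * ‖X a‖) ρ := by
    refine (((h.memLp_Y.sub (h.memLp_X u)).integrable (by norm_num)).norm.mul_const R).mono'
      ((h.measurable_Y.sub (h.measurable_apply measurable_const measurable_id)).abs.mul
        h.measurable_X.norm).aestronglyMeasurable (Eventually.of_forall fun a => ?_)
    rw [Real.norm_of_nonneg (by positivity)]
    exact mul_le_mul_of_nonneg_left (h.norm_X_le _) (abs_nonneg _)
  rw [integral_eq_zero_iff_of_nonneg (fun a => by positivity) hi] at hzero
  rw [add_zero, excessRisk, ← integral_const_mul]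
  refine integral_mono_of_nonneg (Eventually.of_forall fun a => by positivity)
    ((h.memLp_X (v - u)).integrable_sq.const_mul _) ?_
  filter_upwards [hzero] with a ha
  rcases mul_eq_zero.1 ha with h1 | h1
  · have : X a v - Y a = X a (v - u) := by
      rw [map_sub]; linarith [abs_eq_zero.1 h1]
    rw [this, mul_comm]
    gcongr
    exact h.norm_X_le a
  · rw [h1]
    simp only [ne_eq, OfNat.ofNat_ne_zero, not_false_eq_true, zero_pow, mul_zero]
    positivity

theorem R_pos (h : IsSampledOMD Ψ X Y ρ P η z w w₁ u R) (hlam0 : 0 < lam)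
    (hlam : ∀ v, lam * ‖u - v‖ ^ 2 ≤ excessRisk X ρ u v) (hne : u ≠ w₁) : 0 < R := by
  refine h.R_nonneg.lt_of_ne fun hR => ?_
  have h1 := (hlam w₁).trans (h.excessRisk_le w₁)
  rw [← hR] at h1
  have h2 := norm_pos_iff.2 (sub_ne_zero.2 hne)
  have h3 : 0 < lam * ‖u - w₁‖ ^ 2 := by positivity
  simp at h1
  linarith

end IsSampledOMD

/-! ### Covariance matrix, spectral lower bound and normal equations. -/

section Covariance

-- Subtracting `lam` times the identity shifts the spectrum into `[0, ∞)`, so the difference is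
-- positive semidefinite.
open Matrix in
theorem Matrix.IsHermitian.mul_sum_sq_le {n : Type*} [Fintype n] [DecidableEq n]
    {A : Matrix n n ℝ} (hA : A.IsHermitian) {lam : ℝ} (hlam : ∀ r ∈ spectrum ℝ A, lam ≤ r)
    (c : n → ℝ) : lam * ∑ i, c i ^ 2 ≤ ∑ i, ∑ j, c i * c j * A i j := by
  have h1 : (A - algebraMap ℝ _ lam).PosSemidef := by
    rw [Matrix.posSemidef_iff_isHermitian_and_spectrum_nonneg]
    refine ⟨hA.sub ?_, ?_⟩
    · rw [Algebra.algebraMap_eq_smul_one]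
      exact (Matrix.isHermitian_one.smul (IsSelfAdjoint.all lam))
    · rw [← spectrum.sub_singleton_eq]
      rintro _ ⟨r, hr, _, rfl, rfl⟩
      exact sub_nonneg.2 (hlam r hr)
  have h2 := h1.dotProduct_mulVec_nonneg c
  rw [Matrix.sub_mulVec, dotProduct_sub, Algebra.algebraMap_eq_smul_one, Matrix.smul_mulVec,
    Matrix.one_mulVec, dotProduct_smul] at h2
  simp only [dotProduct, Matrix.mulVec, star_trivial, smul_eq_mul, Finset.mul_sum] at h2 ⊢
  have h3 : ∑ i, ∑ j, c i * c j * A i j = ∑ i, ∑ j, c i * (A i j * c j) :=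
    Finset.sum_congr rfl fun i _ => Finset.sum_congr rfl fun j _ => by ring
  have h4 : ∑ i, lam * c i ^ 2 = ∑ i, lam * (c i * c i) :=
    Finset.sum_congr rfl fun i _ => by ring
  rw [h3, h4]
  linarith

theorem Matrix.PosDef.spectrum_pos {n : Type*} [Fintype n] [DecidableEq n]
    {A : Matrix n n ℝ} (hA : A.PosDef) {r : ℝ} (hr : r ∈ spectrum ℝ A) : 0 < r := by
  rw [hA.isHermitian.spectrum_real_eq_range_eigenvalues] at hr
  obtain ⟨i, rfl⟩ := hr
  exact hA.eigenvalues_pos i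

theorem Matrix.PosDef.exists_pos_le_spectrum {n : Type*} [Fintype n] [DecidableEq n]
    {A : Matrix n n ℝ} (hA : A.PosDef) : ∃ lam : ℝ, 0 < lam ∧ ∀ r ∈ spectrum ℝ A, lam ≤ r := by
  rw [hA.isHermitian.spectrum_real_eq_range_eigenvalues]
  rcases isEmpty_or_nonempty n with hn | hn
  · exact ⟨1, one_pos, by rintro _ ⟨i, -⟩; exact isEmptyElim i⟩
  · obtain ⟨i, hi⟩ := Finite.exists_min hA.isHermitian.eigenvalues
    exact ⟨_, hA.eigenvalues_pos i, by rintro _ ⟨j, rfl⟩; exact hi j⟩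

variable {d : ℕ} {E : Type*} [NormedAddCommGroup E] [NormedSpace ℝ E]
  (b : Module.Basis (Fin d) ℝ E)

theorem pNorm_two_sq (v : E) : pNorm b 2 v ^ 2 = ∑ i, b.repr v i ^ 2 := by
  have h0 : 0 ≤ ∑ i, |b.repr v i| ^ (2 : ℝ) := Finset.sum_nonneg fun _ _ => by positivity
  rw [pNorm, ← Real.rpow_natCast, ← Real.rpow_mul h0]
  norm_num

variable {𝒳 : Set (StrongDual ℝ E)} {𝒴 : Set ℝ} {ρ : Measure (𝒳 × 𝒴)} [IsProbabilityMeasure ρ]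
  {R : ℝ}

theorem measurable_input : Measurable fun a : 𝒳 × 𝒴 => (a.1 : StrongDual ℝ E) :=
  measurable_subtype_coe.comp measurable_fst

theorem measurable_output : Measurable fun a : 𝒳 × 𝒴 => (a.2 : ℝ) :=
  measurable_subtype_coe.comp measurable_snd

theorem memLp_input_apply (hR : ∀ x : 𝒳, ‖(x : StrongDual ℝ E)‖ ≤ R) (v : E) :
    MemLp (fun a : 𝒳 × 𝒴 => (a.1 : StrongDual ℝ E) v) 2 ρ := by
  have hm : Measurable fun a : 𝒳 × 𝒴 => (a.1 : StrongDual ℝ E) v :=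
    (ContinuousLinearMap.measurable_apply v).comp measurable_input
  refine MemLp.of_bound hm.aestronglyMeasurable (R * ‖v‖)
    (Eventually.of_forall fun a => ((a.1 : StrongDual ℝ E).le_opNorm v).trans ?_)
  gcongr
  exact hR a.1

theorem integrable_input_mul (hR : ∀ x : 𝒳, ‖(x : StrongDual ℝ E)‖ ≤ R) (v v' : E) :
    Integrable (fun a : 𝒳 × 𝒴 => (a.1 : StrongDual ℝ E) v * (a.1 : StrongDual ℝ E) v') ρ :=
  MemLp.integrable_mul (memLp_input_apply hR v) (memLp_input_apply hR v')

theorem apply_eq_sum_repr (x : StrongDual ℝ E) (v : E) :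
    x v = ∑ i, b.repr v i * x (b i) := by
  conv_lhs => rw [← b.sum_repr v]
  simp only [map_sum, map_smul, smul_eq_mul]

theorem integral_input_sq (hR : ∀ x : 𝒳, ‖(x : StrongDual ℝ E)‖ ≤ R) (v : E) :
    ∫ a, (a.1 : StrongDual ℝ E) v ^ 2 ∂ρ =
      ∑ i, ∑ j, b.repr v i * b.repr v j * covMatrix b ρ i j := by
  have h1 : ∀ a : 𝒳 × 𝒴, (a.1 : StrongDual ℝ E) v ^ 2 = ∑ i, ∑ j, b.repr v i * b.repr v j *
      ((a.1 : StrongDual ℝ E) (b i) * (a.1 : StrongDual ℝ E) (b j)) := fun a => by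
    rw [apply_eq_sum_repr b, sq, Finset.sum_mul_sum]
    exact Finset.sum_congr rfl fun i _ => Finset.sum_congr rfl fun j _ => by ring
  simp_rw [h1]
  rw [integral_finsetSum _ fun i _ => integrable_finsetSum _ fun j _ =>
    (integrable_input_mul hR _ _).const_mul _]
  refine Finset.sum_congr rfl fun i _ => ?_
  rw [integral_finsetSum _ fun j _ => (integrable_input_mul hR _ _).const_mul _]
  refine Finset.sum_congr rfl fun j _ => ?_
  rw [integral_const_mul]
  rfl

/-- The quadratic form of the covariance is bounded below by its spectrum. -/
theorem mul_sum_sq_le_excessRisk (hR : ∀ x : 𝒳, ‖(x : StrongDual ℝ E)‖ ≤ R)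
    (hC : (covMatrix b ρ).PosDef) {lam : ℝ}
    (hlam : ∀ r ∈ spectrum ℝ (covMatrix b ρ), lam ≤ r) (u v : E) :
    lam * ∑ i, b.repr (u - v) i ^ 2 ≤
      excessRisk (fun a : 𝒳 × 𝒴 => (a.1 : StrongDual ℝ E)) ρ u v := by
  have h1 : ∑ i, b.repr (u - v) i ^ 2 = ∑ i, b.repr (v - u) i ^ 2 := by
    refine Finset.sum_congr rfl fun i _ => ?_
    rw [← neg_sub v u, map_neg, Finsupp.neg_apply, neg_sq]
  rw [h1, excessRisk, integral_input_sq b hR]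
  exact hC.isHermitian.mul_sum_sq_le hlam _

theorem exists_mul_norm_sq_le_excessRisk (hR : ∀ x : 𝒳, ‖(x : StrongDual ℝ E)‖ ≤ R)
    (hC : (covMatrix b ρ).PosDef) (u : E) :
    ∃ lam : ℝ, 0 < lam ∧ ∀ v, lam * ‖u - v‖ ^ 2 ≤
      excessRisk (fun a : 𝒳 × 𝒴 => (a.1 : StrongDual ℝ E)) ρ u v := by
  obtain ⟨lam, hlam0, hlam⟩ := hC.exists_pos_le_spectrum
  obtain ⟨K, hK, -, hK2⟩ := exists_repr_bounds b
  refine ⟨lam / K ^ 2, by positivity, fun v => ?_⟩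
  refine le_trans ?_ (mul_sum_sq_le_excessRisk b hR hC hlam u v)
  rw [div_mul_eq_mul_div, div_le_iff₀ (by positivity), mul_assoc, mul_comm _ (K ^ 2)]
  gcongr
  exact hK2 _

/-- The least-squares target solves the normal equations. -/
theorem integral_wRho_residual_mul (hR : ∀ x : 𝒳, ‖(x : StrongDual ℝ E)‖ ≤ R)
    (hY : MemLp (fun a : 𝒳 × 𝒴 => (a.2 : ℝ)) 2 ρ) (hC : (covMatrix b ρ).PosDef) (v : E) :
    ∫ a, ((a.1 : StrongDual ℝ E) (wRho b ρ) - (a.2 : ℝ)) * (a.1 : StrongDual ℝ E) v ∂ρ = 0 := by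
  have hres : MemLp (fun a : 𝒳 × 𝒴 => (a.1 : StrongDual ℝ E) (wRho b ρ) - (a.2 : ℝ)) 2 ρ :=
    (memLp_input_apply hR _).sub hY
  -- The identity is linear in `v`; at the `j`-th basis vector it is the `j`-th row of the linear
  -- system defining `wRho`.
  have hbasis : ∀ j, ∫ a, ((a.1 : StrongDual ℝ E) (wRho b ρ) - (a.2 : ℝ)) *
      (a.1 : StrongDual ℝ E) (b j) ∂ρ = 0 := by
    intro j
    set r : Fin d → ℝ := fun i => ∫ a, (a.1 : StrongDual ℝ E) (b i) * (a.2 : ℝ) ∂ρ with hr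
    have hrepr : ∀ i, b.repr (wRho b ρ) i = (covMatrix b ρ)⁻¹.mulVec r i := fun i => by
      rw [wRho, ← b.equivFun_apply, LinearEquiv.apply_symm_apply]
    have h1 : (covMatrix b ρ).mulVec ((covMatrix b ρ)⁻¹.mulVec r) = r := by
      rw [Matrix.mulVec_mulVec, Matrix.mul_nonsing_inv _
        ((Matrix.isUnit_iff_isUnit_det _).1 hC.isUnit), Matrix.one_mulVec]
    have h2 : ∫ a, (a.1 : StrongDual ℝ E) (wRho b ρ) * (a.1 : StrongDual ℝ E) (b j) ∂ρ =
        r j := by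
      have h3 : ∀ a : 𝒳 × 𝒴, (a.1 : StrongDual ℝ E) (wRho b ρ) * (a.1 : StrongDual ℝ E) (b j) =
          ∑ i, b.repr (wRho b ρ) i *
            ((a.1 : StrongDual ℝ E) (b j) * (a.1 : StrongDual ℝ E) (b i)) := fun a => by
        rw [apply_eq_sum_repr b _ (wRho b ρ), Finset.sum_mul]
        exact Finset.sum_congr rfl fun i _ => by ring
      simp_rw [h3]
      rw [integral_finsetSum _ fun i _ => (integrable_input_mul hR _ _).const_mul _]
      conv_rhs => rw [← h1]
      rw [Matrix.mulVec, dotProduct]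
      refine Finset.sum_congr rfl fun i _ => ?_
      rw [integral_const_mul, hrepr, mul_comm]
      rfl
    have h4 : Integrable (fun a : 𝒳 × 𝒴 => (a.1 : StrongDual ℝ E) (b j) * (a.2 : ℝ)) ρ :=
      MemLp.integrable_mul (memLp_input_apply hR (b j)) hY
    have h5 : ∀ a : 𝒳 × 𝒴, ((a.1 : StrongDual ℝ E) (wRho b ρ) - (a.2 : ℝ)) *
        (a.1 : StrongDual ℝ E) (b j) = (a.1 : StrongDual ℝ E) (wRho b ρ) *
        (a.1 : StrongDual ℝ E) (b j) - (a.1 : StrongDual ℝ E) (b j) * (a.2 : ℝ) :=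
      fun a => by ring
    simp_rw [h5]
    rw [integral_sub (integrable_input_mul hR _ _) h4, h2, hr, sub_self]
  have h1 : ∀ a : 𝒳 × 𝒴, ((a.1 : StrongDual ℝ E) (wRho b ρ) - (a.2 : ℝ)) *
      (a.1 : StrongDual ℝ E) v = ∑ i, b.repr v i *
      (((a.1 : StrongDual ℝ E) (wRho b ρ) - (a.2 : ℝ)) * (a.1 : StrongDual ℝ E) (b i)) :=
    fun a => by
      rw [apply_eq_sum_repr b _ v, Finset.mul_sum]
      exact Finset.sum_congr rfl fun i _ => by ring
  have hint : ∀ i, Integrable (fun a : 𝒳 × 𝒴 =>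
      ((a.1 : StrongDual ℝ E) (wRho b ρ) - (a.2 : ℝ)) * (a.1 : StrongDual ℝ E) (b i)) ρ :=
    fun i => MemLp.integrable_mul hres (memLp_input_apply hR (b i))
  simp_rw [h1]
  rw [integral_finsetSum _ fun i _ => (hint i).const_mul _]
  refine Finset.sum_eq_zero fun i _ => ?_
  rw [integral_const_mul, hbasis, mul_zero]

end Covariance

/-! ### Assembly of the theorem. -/

theorem mainTheorem4 {d : ℕ} {E : Type*} [NormedAddCommGroup E] [NormedSpace ℝ E]
    (b : Module.Basis (Fin d) ℝ E)
    (𝒳 : Set (StrongDual ℝ E)) (𝒴 : Set ℝ)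
    (ρ : Measure (𝒳 × 𝒴)) [IsProbabilityMeasure ρ]
    (hX : BddAbove (Set.range fun x : 𝒳 => ‖(x : StrongDual ℝ E)‖))
    (hY : Integrable (fun z : 𝒳 × 𝒴 => (z.2 : ℝ) ^ 2) ρ)
    (hC : (covMatrix b ρ).PosDef)
    (Ψ : E → ℝ)
    (hΨ : (∃ p : ℝ, 1 < p ∧ p ≤ 2 ∧ Ψ = pNormDivergence b p) ∨
      (IsMirrorMap Ψ ∧ ∃ L : ℝ, 0 < L ∧ IsStronglySmooth Ψ L))
    {Ω : Type*} [MeasurableSpace Ω] (P : Measure Ω) [IsProbabilityMeasure P]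
    (z : ℕ → Ω → 𝒳 × 𝒴)
    (hz_meas : ∀ t, 1 ≤ t → Measurable (z t))
    (hz_law : ∀ t, 1 ≤ t → P.map (z t) = ρ)
    (hz_indep : iIndepFun (fun t : ℕ => z (t + 1)) P)
    (η : ℕ → ℝ) (hη : ∀ t, 1 ≤ t → 0 < η t)
    (w₁ : E) (w : ℕ → Ω → E) (hw : IsLeastSquaresOMD Ψ η w₁ z w) :
    -- the expectations below are finite
    (∀ t, 1 ≤ t → Integrable (fun ω => ‖wRho b ρ - w t ω‖ ^ 2) P) ∧
    -- (a) positive variances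
    (0 < ⨅ v : E, meanGradNorm ρ v →
      (Tendsto (fun t : ℕ => ∫ ω, ‖wRho b ρ - w t ω‖ ^ 2 ∂P) atTop (𝓝 0) ↔
        Tendsto η atTop (𝓝 0) ∧ StepSumDiverges η) ∧
      ((∃ L : ℝ, 0 < L ∧ IsStronglySmooth Ψ L) → Tendsto η atTop (𝓝 0) →
        ∃ T₁ : ℕ, ∃ C : ℝ, 0 < C ∧ ∀ T : ℕ, T₁ ≤ T →
          C * (T : ℝ)⁻¹ ≤ ∫ ω, ‖wRho b ρ - w T ω‖ ^ 2 ∂P) ∧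
      (∀ L : ℝ, 0 < L → IsStronglySmooth Ψ L →
        ∀ lam : ℝ, IsLeast (spectrum ℝ (covMatrix b ρ)) lam →
        ∀ β : ℝ, 0 < β → (∀ v : E, β * ‖v‖ ^ 2 ≤ pNorm b 2 v ^ 2) →
        (∀ t : ℕ, 1 ≤ t → η t = 4 / (((t : ℝ) + 1) * (2 * lam * β / L))) →
        (fun T : ℕ => ∫ ω, ‖wRho b ρ - w T ω‖ ^ 2 ∂P) =O[atTop] fun T : ℕ => (T : ℝ)⁻¹)) ∧
    -- (b) zero variances
    (wRho b ρ ≠ w₁ → meanGradNorm ρ (wRho b ρ) = 0 →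
      ∀ σ : ℝ, 0 < σ → IsStronglyConvex Ψ σ →
      ((∃ κ : ℝ, 0 < κ ∧ ∀ t, 1 ≤ t →
          η t ≤ σ / ((2 + κ) * (⨆ x : 𝒳, ‖(x : StrongDual ℝ E)‖) ^ 2)) →
        (Tendsto (fun t : ℕ => ∫ ω, ‖wRho b ρ - w t ω‖ ^ 2 ∂P) atTop (𝓝 0) ↔
          StepSumDiverges η)) ∧
      (∀ L : ℝ, 0 < L → IsStronglySmooth Ψ L →
        (∀ t, 1 ≤ t → η t = η 1) →
        η 1 < σ / (2 * (⨆ x : 𝒳, ‖(x : StrongDual ℝ E)‖) ^ 2) →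
        ∃ c₁ ∈ Set.Ioo (0 : ℝ) 1, ∃ c₂ ∈ Set.Ioo (0 : ℝ) 1, ∀ T : ℕ, 1 ≤ T →
          c₁ ^ T * ‖wRho b ρ - w₁‖ ^ 2 ≤ ∫ ω, ‖wRho b ρ - w T ω‖ ^ 2 ∂P ∧
          ∫ ω, ‖wRho b ρ - w T ω‖ ^ 2 ∂P ≤
            L / σ * c₂ ^ (T - 1) * ‖wRho b ρ - w₁‖ ^ 2)) ∧
    -- (c) almost sure convergence
    (StepSumDiverges η → Summable (fun t : ℕ => η t ^ 2) →
      ∀ᵐ ω ∂P, Tendsto (fun t : ℕ => ‖wRho b ρ - w t ω‖ ^ 2) atTop (𝓝 0)) := by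
  have hfin : FiniteDimensional ℝ E := b.finiteDimensional_of_finite
  borelize E
  have hR : ∀ x : 𝒳, ‖(x : StrongDual ℝ E)‖ ≤ ⨆ x : 𝒳, ‖(x : StrongDual ℝ E)‖ :=
    fun x => le_ciSup hX x
  have hY2 : MemLp (fun a : 𝒳 × 𝒴 => (a.2 : ℝ)) 2 ρ :=
    (memLp_two_iff_integrable_sq measurable_output.aestronglyMeasurable).2 hY
  have hreg : Differentiable ℝ Ψ ∧ HasLinearGradGrowth Ψ ∧
      ∃ σ : ℝ, 0 < σ ∧ IsStronglyConvex Ψ σ := by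
    rcases hΨ with ⟨p, hp1, hp2, rfl⟩ | ⟨⟨hd, σ, hσ, hconv⟩, L, hL0, hL⟩
    · exact ⟨differentiable_pNormDivergence b hp1 hp2,
        hasLinearGradGrowth_pNormDivergence b hp1 hp2,
        exists_isStronglyConvex_pNormDivergence b hp1 hp2⟩
    · exact ⟨hd, hL.hasLinearGradGrowth hL0 hconv hσ, σ, hσ, hconv⟩
  have h : IsSampledOMD Ψ (fun a : 𝒳 × 𝒴 => (a.1 : StrongDual ℝ E)) (fun a => (a.2 : ℝ)) ρ P η
      z w w₁ (wRho b ρ) (⨆ x : 𝒳, ‖(x : StrongDual ℝ E)‖) :=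
    { differentiable := hreg.1
      growth := hreg.2.1
      exists_convex := hreg.2.2
      measurable_X := measurable_input
      measurable_Y := measurable_output
      norm_X_le := fun a => hR a.1
      memLp_Y := hY2
      measurable_z := hz_meas
      map_z := hz_law
      indep := hz_indep
      step_pos := hη
      init := hw.init
      step := hw.step
      normal := integral_wRho_residual_mul b hR hY2 hC }
  obtain ⟨lam, hlam0, hlam⟩ := exists_mul_norm_sq_le_excessRisk b hR hC (wRho b ρ)
  refine ⟨fun t ht => h.integrable_error ht, fun hinf => ?_, fun hne hzero σ hσ hconv => ?_,
    fun hsum hsq => h.ae_tendsto_error (integral_nonneg fun _ => sq_nonneg _)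
      h.integral_gradSq_le hlam0 hlam hsum hsq⟩
  · have hm : ∀ v : E, ⨅ v : E, meanGradNorm ρ v ≤ meanGradNorm ρ v := fun v =>
      ciInf_le ⟨0, by rintro _ ⟨v, rfl⟩; exact integral_nonneg fun a => by positivity⟩ v
    refine ⟨h.tendsto_iff_of_noise h.integral_gradSq_le hlam0 hlam hinf hm, ?_, ?_⟩
    · rintro ⟨L, hL0, hL⟩ hη0
      exact h.exists_inv_le_error hinf hm hL0 hL hη0
    · intro L hL0 hL μ hμ β hβ hβn hstep
      have hμ0 : 0 < μ := hC.spectrum_pos hμ.1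
      refine h.error_isBigO_inv (integral_nonneg fun _ => sq_nonneg _) h.integral_gradSq_le
        (by positivity) (fun v => ?_) hstep
      have h1 := mul_sum_sq_le_excessRisk b hR hC (fun r hr => hμ.2 hr) (wRho b ρ) v
      rw [← pNorm_two_sq] at h1
      -- The constant `2 * μ * β / L` combines smoothness `L / 2`, the norm comparison `β` and the
      -- smallest eigenvalue `μ`, so that it times the divergence is at most the excess risk.
      calc 2 * μ * β / L * bregman Ψ (wRho b ρ) v
          ≤ 2 * μ * β / L * (L / 2 * ‖wRho b ρ - v‖ ^ 2) := by
            gcongr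
            exact hL _ _
        _ = μ * (β * ‖wRho b ρ - v‖ ^ 2) := by field_simp
        _ ≤ μ * pNorm b 2 (wRho b ρ - v) ^ 2 := by
            gcongr
            exact hβn _
        _ ≤ _ := h1
  · have hV := h.integral_gradSq_le_of_noiseless hzero
    have hR0 := h.R_pos hlam0 hlam hne
    refine ⟨?_, fun L hL0 hL hconst hη1 =>
      h.linear_rate_of_noiseless hσ hconv hR0 hV hlam0 hlam hne hL0 hL hconst hη1⟩
    rintro ⟨κ, hκ, hstep⟩
    exact h.tendsto_iff_of_noiseless hσ hconv hR0 hV hlam0 hlam hne hκ hstep
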